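/- \textbf{Theorem.} Let $\alpha$ be a rational number with $0\le\alpha<1$. For each of the three kinds of votes (top orders, bottom orders, weak orders) and each of the two domain restrictions (single-peaked, single-plateaued), the following decision problem, Copeland$^\alpha$-CWCM, is in $\mathrm{P}$ (weights are written in binary). \emph{Input:} a finite candidate set $C$; a total order $L$ of $C$ (the axis); a list of nonmanipulators, each with a positive integer weight and a vote on $C$ of the given kind satisfying the given restriction with respect to $L$; a list of manipulators, each with a positive integer weight; and a candidate $p\in C$. \emph{Question:} can each manipulator be given a vote on $C$ of the given kind satisfying the given restriction with respect to $L$, so that $p$ is a (not necessarily unique) Copeland$^\alpha$ winner of the weighted election consisting of all nonmanipulators and manipulators? Here a weak order is a complete, reflexive, transitive relation, written $G_1>G_2>\dots>G_r$ with nonempty groups $G_i$ of tied candidates. It is a top order if every group except possibly $G_r$ is a singleton, and a bottom order if every group except possibly $G_1$ is a singleton. A vote $v$ is \emph{single-plateaued} with respect to $L$ if $L$ splits into consecutive segments $X$, $Y$, $Z$ ($X$ and $Z$ possibly empty) such that $Y$ is the set of most preferred candidates of $v$, $v$ is strictly increasing along $X$ (each candidate is strictly preferred to those on its left) and strictly decreasing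 along $Z$; it is \emph{single-peaked} if moreover $Y$ consists of a single candidate. In a Copeland$^\alpha$ election a candidate $a$ receives, for each other candidate $b$, one point if the total weight of the voters who strictly prefer $a$ to $b$ exceeds the total weight of those who strictly prefer $b$ to $a$, and $\alpha$ points if these two weights are equal; the winners are the candidates with the highest score. -/

import Mathlib

/-! ### Votes with ties -/

namespace TiedVoting

/-- Candidates are named by natural numbers. A vote with ties `G₁ > G₂ > ⋯ > G_r` is the list
`[G₁, …, G_r]` of its groups of tied candidates, from most to least preferred. -/
abbrev Vote : Type := List (List ℕ)

/-- `v` is a weak order on the candidates listed (without repetition) in `C`: its groups are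
nonempty and they partition `C`. -/
def IsWeakOrder (C : List ℕ) (v : Vote) : Prop :=
  (∀ G ∈ v, G ≠ []) ∧ v.flatten.Perm C

/-- The index of the group of `v` that contains `a`. -/
def position (v : Vote) (a : ℕ) : ℕ := v.findIdx (fun G => decide (a ∈ G))

/-- `v` strictly prefers `a` to `b`. -/
def Prefers (v : Vote) (a b : ℕ) : Prop := position v a < position v b

instance (v : Vote) (a b : ℕ) : Decidable (Prefers v a b) :=
  inferInstanceAs (Decidable (position v a < position v b))

/-- The kinds of votes with ties. -/
inductive OrderKind
  | top
  | bottom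
  | weak

/-- In a top order only the bottom-ranked candidates may be tied with one another, in a bottom
order only the top-ranked ones; a weak order is not restricted. -/
def OrderKind.Allows : OrderKind → Vote → Prop
  | .top, v => ∀ G ∈ v.dropLast, G.length = 1
  | .bottom, v => ∀ G ∈ v.tail, G.length = 1
  | .weak, _ => True

/-! ### Single-peaked and single-plateaued votes

An axis `L` is the list of all candidates, from left to right. -/

/-- No candidate on `L` is strictly preferred to `a`. -/
def MostPreferred (L : List ℕ) (v : Vote) (a : ℕ) : Prop := ∀ b ∈ L, ¬ Prefers v b a

/-- Each candidate of the segment is strictly preferred to all candidates on its left. -/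
def StrictlyIncreasing (v : Vote) (X : List ℕ) : Prop := X.Pairwise (fun a b => Prefers v b a)

/-- Each candidate of the segment is strictly preferred to all candidates on its right. -/
def StrictlyDecreasing (v : Vote) (Z : List ℕ) : Prop := Z.Pairwise (fun a b => Prefers v a b)

/-- The axis splits into segments `X`, `Y`, `Z` such that `Y` consists of the most preferred
candidates, and `v` is strictly increasing along `X` and strictly decreasing along `Z`. -/
def SinglePlateaued (L : List ℕ) (v : Vote) : Prop :=
  ∃ X Y Z : List ℕ, L = X ++ Y ++ Z ∧ (∀ a ∈ L, a ∈ Y ↔ MostPreferred L v a) ∧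
    StrictlyIncreasing v X ∧ StrictlyDecreasing v Z

/-- As above, with a unique most preferred candidate. -/
def SinglePeaked (L : List ℕ) (v : Vote) : Prop :=
  ∃ (X : List ℕ) (y : ℕ) (Z : List ℕ), L = X ++ [y] ++ Z ∧
    (∀ a ∈ L, a = y ↔ MostPreferred L v a) ∧
    StrictlyIncreasing v X ∧ StrictlyDecreasing v Z

/-- The two domain restrictions. -/
inductive Shape
  | singlePeaked
  | singlePlateaued

def Shape.Allows : Shape → List ℕ → Vote → Prop
  | .singlePeaked, L, v => SinglePeaked L v
  | .singlePlateaued, L, v => SinglePlateaued L v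

/-- The votes that may be cast, for a kind of order, a domain restriction and an axis. -/
def Admissible (k : OrderKind) (s : Shape) (L : List ℕ) (v : Vote) : Prop :=
  IsWeakOrder L v ∧ k.Allows v ∧ s.Allows L v

/-! ### Weighted Copeland elections -/

/-- A weighted profile: each voter has a weight and a vote. -/
abbrev Profile : Type := List (ℕ × Vote)

/-- The total weight of the voters who strictly prefer `a` to `b`. -/
def support (V : Profile) (a b : ℕ) : ℕ :=
  (V.map (fun x => if Prefers x.2 a b then x.1 else 0)).sum

/-- The Copeland score with parameter `α`: one point for each pairwise majority election won and
`α` points for each one that ends in a tie. -/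
def copelandScore (α : ℚ) (C : Finset ℕ) (V : Profile) (a : ℕ) : ℚ :=
  (((C.erase a).filter (fun b => support V b a < support V a b)).card : ℚ) +
    α * (((C.erase a).filter (fun b => support V a b = support V b a)).card : ℚ)

/-- `p` is a (not necessarily unique) Copeland winner. -/
def IsCopelandWinner (α : ℚ) (C : Finset ℕ) (V : Profile) (p : ℕ) : Prop :=
  p ∈ C ∧ ∀ c ∈ C, copelandScore α C V c ≤ copelandScore α C V p

/-! ### Constructive weighted coalitional manipulation -/

/-- The data of an input: the axis (which also lists the candidates), the weighted votes of the
nonmanipulators, the weights of the manipulators, and the preferred candidate. -/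
structure CWCMInstance where
  axis : List ℕ
  nonmanipulators : Profile
  manipulators : List ℕ
  preferred : ℕ

/-- The data form an instance of the manipulation problem for the given kind of orders and the
given domain restriction. -/
def CWCMInstance.Valid (I : CWCMInstance) (k : OrderKind) (s : Shape) : Prop :=
  I.axis.Nodup ∧ I.preferred ∈ I.axis ∧
    (∀ x ∈ I.nonmanipulators, 0 < x.1 ∧ Admissible k s I.axis x.2) ∧
    (∀ w ∈ I.manipulators, 0 < w)

/-- The manipulators can cast admissible votes (the `i`-th vote is cast by the `i`-th manipulator)
such that the preferred candidate is a winner. -/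
def CWCMInstance.Manipulable (I : CWCMInstance) (α : ℚ) (k : OrderKind) (s : Shape) : Prop :=
  ∃ votes : List Vote, votes.length = I.manipulators.length ∧
    (∀ v ∈ votes, Admissible k s I.axis v) ∧
    IsCopelandWinner α I.axis.toFinset (I.nonmanipulators ++ I.manipulators.zip votes) I.preferred

/-! ### Encoding of instances as words, with all numbers in binary -/

/-- A finite alphabet with two bits, brackets and a comma. -/
abbrev Symbol : Type := Computability.Γ'

/-- A natural number: its binary digits, terminated by a comma. -/
def encodeNumber (n : ℕ) : List Symbol :=
  (Computability.encodeNat n).map Computability.Γ'.bit ++ [Computability.Γ'.comma]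

/-- A list: the codes of its entries between brackets. -/
def encodeSeq {β : Type} (e : β → List Symbol) (l : List β) : List Symbol :=
  Computability.Γ'.bra :: (l.flatMap e ++ [Computability.Γ'.ket])

def encodeVote (v : Vote) : List Symbol := encodeSeq (encodeSeq encodeNumber) v

def encodeVoter (x : ℕ × Vote) : List Symbol := encodeNumber x.1 ++ encodeVote x.2

def CWCMInstance.encode (I : CWCMInstance) : List Symbol :=
  encodeSeq encodeNumber I.axis ++ (encodeSeq encodeVoter I.nonmanipulators ++
    (encodeSeq encodeNumber I.manipulators ++ encodeNumber I.preferred))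

/-- The decision problem Copeland-`α`-CWCM for the given kind of orders and the given domain
restriction, as a formal language. -/
def copelandCWCM (α : ℚ) (k : OrderKind) (s : Shape) : Set (List Symbol) :=
  {w | ∃ I : CWCMInstance, I.encode = w ∧ I.Valid k s ∧ I.Manipulable α k s}

open Classical in
/-- The class P: languages whose characteristic function is computed in polynomial time by a
(multi-stack) Turing machine. -/
def InP {Γ : Type} (A : Set (List Γ)) : Prop :=
  Nonempty (Turing.TM2ComputableInPolyTime (id : List Γ → List Γ) Computability.encodeBool
    (fun w => decide (w ∈ A)))

/-! ### The encoding of instances is injective -/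

/-- Codewords can be split off unambiguously. -/
def PrefixCode {β : Type} (e : β → List Symbol) : Prop :=
  ∀ x y r t, e x ++ r = e y ++ t → x = y ∧ r = t

theorem prefixCode_encodeNumber : PrefixCode encodeNumber := by
  have key : ∀ (a b : List Bool) (r t : List Symbol),
      a.map Computability.Γ'.bit ++ ([Computability.Γ'.comma] ++ r) =
        b.map Computability.Γ'.bit ++ ([Computability.Γ'.comma] ++ t) → a = b ∧ r = t := by
    intro a
    induction a with
    | nil => intro b r t h; cases b <;> simp_all
    | cons x a ih =>
      intro b r t h
      cases b with
      | nil => simp at h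
      | cons y b =>
        simp only [List.map_cons, List.cons_append, List.cons.injEq,
          Computability.Γ'.bit.injEq] at h
        obtain ⟨h1, h2⟩ := ih b r t h.2
        exact ⟨by rw [h.1, h1], h2⟩
  intro x y r t h
  simp only [encodeNumber, List.append_assoc] at h
  obtain ⟨h1, h2⟩ := key _ _ _ _ h
  refine ⟨?_, h2⟩
  have := congrArg Computability.decodeNat h1
  simpa using this

theorem prefixCode_encodeSeq {β : Type} {e : β → List Symbol} (he : PrefixCode e)
    (hk : ∀ x r t, e x ++ r ≠ Computability.Γ'.ket :: t) : PrefixCode (encodeSeq e) := by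
  intro a
  induction a with
  | nil =>
    intro b r t h
    cases b with
    | nil => simpa [encodeSeq] using h
    | cons y b =>
      simp only [encodeSeq, List.flatMap_nil, List.flatMap_cons, List.cons_append,
        List.cons.injEq, true_and, List.append_assoc, List.nil_append] at h
      exact absurd h.symm (hk _ _ _)
  | cons x a ih =>
    intro b r t h
    cases b with
    | nil =>
      simp only [encodeSeq, List.flatMap_nil, List.flatMap_cons, List.cons_append,
        List.cons.injEq, true_and, List.append_assoc, List.nil_append] at h
      exact absurd h (hk _ _ _)
    | cons y b =>
      simp only [encodeSeq, List.flatMap_cons, List.cons_append,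
        List.cons.injEq, true_and, List.append_assoc] at h
      obtain ⟨rfl, h⟩ := he _ _ _ _ h
      obtain ⟨rfl, rfl⟩ := ih b r t (by simpa [encodeSeq] using h)
      exact ⟨rfl, rfl⟩

theorem encodeNumber_ne_ket (n : ℕ) (r t : List Symbol) :
    encodeNumber n ++ r ≠ Computability.Γ'.ket :: t := by
  unfold encodeNumber
  cases Computability.encodeNat n <;> simp

theorem encodeSeq_ne_ket {β : Type} (e : β → List Symbol) (l : List β) (r t : List Symbol) :
    encodeSeq e l ++ r ≠ Computability.Γ'.ket :: t := by
  simp [encodeSeq]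

theorem prefixCode_encodeVote : PrefixCode encodeVote :=
  prefixCode_encodeSeq (prefixCode_encodeSeq prefixCode_encodeNumber encodeNumber_ne_ket)
    (encodeSeq_ne_ket _)

theorem prefixCode_encodeVoter : PrefixCode encodeVoter := by
  rintro ⟨w, v⟩ ⟨w', v'⟩ r t h
  simp only [encodeVoter, List.append_assoc] at h
  obtain ⟨rfl, h₁⟩ := prefixCode_encodeNumber _ _ _ _ h
  obtain ⟨rfl, rfl⟩ := prefixCode_encodeVote _ _ _ _ h₁
  exact ⟨rfl, rfl⟩

theorem CWCMInstance.encode_injective : Function.Injective CWCMInstance.encode := by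
  rintro ⟨a, S, T, p⟩ ⟨a', S', T', p'⟩ h
  have hn := prefixCode_encodeSeq prefixCode_encodeNumber encodeNumber_ne_ket
  have hv : PrefixCode (encodeSeq encodeVoter) :=
    prefixCode_encodeSeq prefixCode_encodeVoter fun x r t => by
      simp only [encodeVoter, List.append_assoc]
      exact encodeNumber_ne_ket _ _ _
  simp only [CWCMInstance.encode] at h
  obtain ⟨rfl, h₁⟩ := hn _ _ _ _ h
  obtain ⟨rfl, h₂⟩ := hv _ _ _ _ h₁
  obtain ⟨rfl, h₃⟩ := hn _ _ _ _ h₂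
  obtain ⟨rfl, -⟩ := prefixCode_encodeNumber p p' [] [] (by simpa using h₃)
  rfl

end TiedVoting

/-! The combinatorial core is that only two joint manipulations have to be tried. In a
single-plateaued vote, of three candidates on the axis the middle one never forms a valley
(`Unimodal`). Summing over the voters, a candidate `p` that loses a pairwise election to `a` has a
strictly smaller Copeland score than `a` (`copelandScore_lt_of_pos_lt`). So a Copeland winner loses
to nobody (`margin_nonneg_of_isMax`), and the only rivals of an unbeaten `p` are candidates tied
with it.

Start from a successful manipulation and replace every manipulator's vote by the ballot that ranks
`p` first, then one side of the axis outwards from `p`, then the other side outwards. The margins of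
`p` can only grow. Suppose a candidate `c` on the side ranked last has the highest score afterwards.
Then `c` is tied with `p`, so every manipulator had preferred `p` to `c` before; otherwise `c` would
have beaten `p`. By unimodality these votes already placed `c` above everything beyond it, and the
new ballot places `c` below everything else, so `c` has gained nothing and does not overtake `p`
(`isCopelandWinner_of_isCopelandWinner`). It remains to exclude ties with candidates on the side
ranked first. Unimodality of the nonmanipulators forbids ties on both sides at once
(`margin_add_le`), so the side that contains ties is ranked last. Both ballots are linear orders
with peak `p`, hence admissible for every kind of vote and both restrictions; this gives
`manipulable_iff`.

For the complexity claim, `Poly` is a class of functions computed by structured stack programs in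
polynomial time with output of polynomial size. It is closed under composition, pairing, case
distinction and folds whose intermediate states stay polynomially small (`Poly.foldl_of_bound`).
Binary arithmetic, parsing, the validity test and the scores are assembled from these closure
properties. `Run.stepsTo` compiles programs to `TM2` machines, and `Poly.inP` concludes membership
in P. -/

/-! ### Structured stack programs and their compilation to `TM2` machines -/

namespace PolyTime

/-- Structured programs over stacks with alphabets `Γ k`. `cond` pops a symbol and branches on it,
`loop` pops symbols from a stack, running its body for each, until that stack is empty. -/
inductive Prog {K : Type} (Γ : K → Type) : Type
  | skip : Prog Γ
  | push (k : K) (a : Γ k) : Prog Γ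
  | seq (P Q : Prog Γ) : Prog Γ
  | cond (k : K) (P : Option (Γ k) → Prog Γ) : Prog Γ
  | loop (k : K) (P : Γ k → Prog Γ) : Prog Γ

namespace Prog

variable {K : Type} {Γ : K → Type}

/-- The control points of a program. -/
def Label : Prog Γ → Type
  | skip => Unit
  | push _ _ => Unit
  | seq P Q => P.Label ⊕ Q.Label
  | cond _ P => Option (Σ o, (P o).Label)
  | loop _ P => Option (Σ a, (P a).Label)

/-- The first control point of a program. -/
def entry : (P : Prog Γ) → P.Label
  | skip => ()
  | push _ _ => ()
  | seq P _ => Sum.inl P.entry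
  | cond _ _ => none
  | loop _ _ => none

instance finite_label [∀ k, Finite (Γ k)] : (P : Prog Γ) → Finite P.Label
  | skip => inferInstanceAs (Finite Unit)
  | push _ _ => inferInstanceAs (Finite Unit)
  | seq P Q =>
    have := finite_label P
    have := finite_label Q
    inferInstanceAs (Finite (P.Label ⊕ Q.Label))
  | cond _ P =>
    have := fun o => finite_label (P o)
    inferInstanceAs (Finite (Option (Σ o, (P o).Label)))
  | loop _ P =>
    have := fun a => finite_label (P a)
    inferInstanceAs (Finite (Option (Σ a, (P a).Label)))

variable [DecidableEq K] {Λ : Type}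

/-- The internal states of the compiled machines: the symbols last read from the stacks. -/
abbrev Mem (Γ : K → Type) : Type := ∀ k, Option (Γ k)

/-- The statement executed at a control point, given names in `Λ` for the control points and the
label at which to continue after the program. -/
def body : (P : Prog Γ) → (P.Label → Λ) → Λ → P.Label → Turing.TM2.Stmt Γ Λ (Mem Γ)
  | skip, _, x, _ => .goto fun _ => x
  | push k a, _, x, _ => .push k (fun _ => a) (.goto fun _ => x)
  | seq P Q, e, x, l => match l with
    | Sum.inl l => P.body (fun l => e (Sum.inl l)) (e (Sum.inr Q.entry)) l
    | Sum.inr l => Q.body (fun l => e (Sum.inr l)) x l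
  | cond k P, e, x, l => match l with
    | none => .pop k (fun v o => Function.update v k o)
        (.goto fun v => e (some ⟨v k, (P (v k)).entry⟩))
    | some ⟨o, l⟩ => (P o).body (fun l => e (some ⟨o, l⟩)) x l
  | loop k P, e, x, l => match l with
    | none => .pop k (fun v o => Function.update v k o)
        (.goto fun v => match v k with
          | none => x
          | some a => e (some ⟨a, (P a).entry⟩))
    | some ⟨a, l⟩ => (P a).body (fun l => e (some ⟨a, l⟩)) (e none) l

/-- `Run P S S' t`: started with stacks `S`, the program `P` ends with stacks `S'` after `t`
steps. -/
inductive Run : Prog Γ → (∀ k, List (Γ k)) → (∀ k, List (Γ k)) → ℕ → Prop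
  | skip (S) : Run skip S S 1
  | push (k a S) : Run (push k a) S (Function.update S k (a :: S k)) 1
  | seq {P Q S S' S'' t t'} : Run P S S' t → Run Q S' S'' t' → Run (seq P Q) S S'' (t + t')
  | cond {k P S S' t} : Run (P (S k).head?) (Function.update S k (S k).tail) S' t →
      Run (cond k P) S S' (t + 1)
  | loop_nil {k P S} : S k = [] → Run (loop k P) S S 1
  | loop_cons {k P S S' S'' a l t t'} : S k = a :: l → Run (P a) (Function.update S k l) S' t →
      Run (loop k P) S' S'' t' → Run (loop k P) S S'' (t + t' + 1)

/-- `n` steps of the machine `M` lead from `c` to `c'`. -/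
def StepsTo (M : Λ → Turing.TM2.Stmt Γ Λ (Mem Γ)) (c c' : Turing.TM2.Cfg Γ Λ (Mem Γ)) (n : ℕ) :
    Prop :=
  (flip bind (Turing.TM2.step M))^[n] (some c) = some c'

theorem StepsTo.trans {M : Λ → Turing.TM2.Stmt Γ Λ (Mem Γ)} {c c' c'' : Turing.TM2.Cfg Γ Λ (Mem Γ)}
    {m n : ℕ} (h : StepsTo M c c' m) (h' : StepsTo M c' c'' n) : StepsTo M c c'' (m + n) := by
  unfold StepsTo at *
  rw [add_comm, Function.iterate_add_apply, h, h']

theorem StepsTo.single {M : Λ → Turing.TM2.Stmt Γ Λ (Mem Γ)} {c c' : Turing.TM2.Cfg Γ Λ (Mem Γ)}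
    (h : Turing.TM2.step M c = some c') : StepsTo M c c' 1 := h

/-- The hypothesis `hM` says that `M` contains a copy of `P` at the labels `e`, with exit `x`. This
is stable under passing to subprograms, so induction on the run works: the exit of a first part is
the entry of the next, and the exit of a loop body is the head of the loop. The final memory is left
unspecified, since a program reads its memory only directly after the pop that sets it. -/
theorem Run.stepsTo {M : Λ → Turing.TM2.Stmt Γ Λ (Mem Γ)} {P : Prog Γ} {S S' : ∀ k, List (Γ k)}
    {t : ℕ} (h : Run P S S' t) (e : P.Label → Λ) (x : Λ) (hM : ∀ l, M (e l) = P.body e x l)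
    (v : Mem Γ) : ∃ v', StepsTo M ⟨some (e P.entry), v, S⟩ ⟨some x, v', S'⟩ t := by
  induction h generalizing x v with
  | skip S => exact ⟨v, .single (by simp [Turing.TM2.step, hM, body])⟩
  | push k a S => exact ⟨v, .single (by simp [Turing.TM2.step, hM, body])⟩
  | @seq P Q S S' S'' t t' _ _ ih ih' =>
    obtain ⟨v', h⟩ := ih (fun l => e (Sum.inl l)) (e (Sum.inr Q.entry))
      (fun l => hM (Sum.inl l)) v
    obtain ⟨v'', h'⟩ := ih' (fun l => e (Sum.inr l)) x (fun l => hM (Sum.inr l)) v'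
    exact ⟨v'', h.trans h'⟩
  | @cond k P S S' t _ ih =>
    obtain ⟨v', h⟩ := ih (fun l => e (some ⟨_, l⟩)) x (fun l => hM (some ⟨_, l⟩))
      (Function.update v k (S k).head?)
    refine ⟨v', ?_⟩
    rw [add_comm]
    refine StepsTo.trans (.single ?_) h
    have := hM none
    simp only [Turing.TM2.step, entry, this, body, Turing.TM2.stepAux, Option.some.injEq,
      Turing.TM2.Cfg.mk.injEq, and_true]
    exact congrArg (fun o => e (some ⟨o, (P o).entry⟩)) (Function.update_self ..)
  | @loop_nil k P S hS =>
    have := hM none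
    refine ⟨Function.update v k none, .single ?_⟩
    have h2 : Function.update S k [] = S := by rw [← hS, Function.update_eq_self]
    simp [Turing.TM2.step, entry, this, body, hS, h2]
  | @loop_cons k P S S' S'' a l t t' hS _ _ ih ih' =>
    obtain ⟨v', h⟩ := ih (fun l => e (some ⟨a, l⟩)) (e none) (fun l => hM (some ⟨_, l⟩))
      (Function.update v k (some a))
    obtain ⟨v'', h'⟩ := ih' e x hM v'
    refine ⟨v'', ?_⟩
    rw [add_comm]
    refine StepsTo.trans (.single ?_) (h.trans h')
    have := hM none
    simp [Turing.TM2.step, entry, this, body, hS]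

/-- `P` leads from `S` to `S'` in at most `t` steps. -/
def RunLE (P : Prog Γ) (S S' : ∀ k, List (Γ k)) (t : ℕ) : Prop := ∃ n ≤ t, Run P S S' n

theorem RunLE.mono {P : Prog Γ} {S S' : ∀ k, List (Γ k)} {t t' : ℕ} (h : RunLE P S S' t)
    (ht : t ≤ t') : RunLE P S S' t' := by
  obtain ⟨n, hn, h⟩ := h
  exact ⟨n, hn.trans ht, h⟩

theorem runLE_skip (S : ∀ k, List (Γ k)) : RunLE skip S S 1 := ⟨1, le_rfl, .skip S⟩

theorem runLE_push (k : K) (a : Γ k) (S : ∀ k, List (Γ k)) :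
    RunLE (push k a) S (Function.update S k (a :: S k)) 1 := ⟨1, le_rfl, .push k a S⟩

theorem RunLE.seq {P Q : Prog Γ} {S S' S'' : ∀ k, List (Γ k)} {t t' : ℕ} (h : RunLE P S S' t)
    (h' : RunLE Q S' S'' t') : RunLE (seq P Q) S S'' (t + t') := by
  obtain ⟨n, hn, h⟩ := h
  obtain ⟨n', hn', h'⟩ := h'
  exact ⟨_, by omega, .seq h h'⟩

theorem RunLE.cond {k : K} {P : Option (Γ k) → Prog Γ} {S S' : ∀ k, List (Γ k)} {t : ℕ}
    (h : RunLE (P (S k).head?) (Function.update S k (S k).tail) S' t) :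
    RunLE (cond k P) S S' (t + 1) := by
  obtain ⟨n, hn, h⟩ := h
  exact ⟨_, by omega, .cond h⟩

theorem runLE_loop_nil {k : K} (P : Γ k → Prog Γ) {S : ∀ k, List (Γ k)} (h : S k = []) :
    RunLE (loop k P) S S 1 := ⟨1, le_rfl, .loop_nil h⟩

theorem RunLE.loop_cons {k : K} {P : Γ k → Prog Γ} {S S' S'' : ∀ k, List (Γ k)} {a : Γ k}
    {l : List (Γ k)} {t t' : ℕ} (hS : S k = a :: l)
    (h : RunLE (P a) (Function.update S k l) S' t) (h' : RunLE (loop k P) S' S'' t') :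
    RunLE (loop k P) S S'' (t + t' + 1) := by
  obtain ⟨n, hn, h⟩ := h
  obtain ⟨n', hn', h'⟩ := h'
  exact ⟨_, by omega, .loop_cons hS h h'⟩

/-- The machine that runs a program and halts. -/
noncomputable def machine [Fintype K] [∀ k, Fintype (Γ k)] (P : Prog Γ) (k₀ k₁ : K) :
    Turing.FinTM2 where
  K := K
  k₀ := k₀
  k₁ := k₁
  Γ := Γ
  Λ := Option P.Label
  main := some P.entry
  ΛFin := Fintype.ofFinite _
  σ := Mem Γ
  initialState := fun _ => none
  m := fun l => match l with
    | none => .load (fun _ _ => none) .halt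
    | some l => P.body some none l

/-- `Turing.initList` and `Turing.haltList` describe the stacks by a dependent `if`; programs
describe them by `Function.update`. -/
theorem dite_eq_update (k₀ : K) (w : List (Γ k₀)) :
    (fun k => if h : k = k₀ then (by rw [h]; exact w : List (Γ k)) else []) =
      Function.update (fun _ => []) k₀ w := by
  funext k
  by_cases hk : k = k₀
  · subst hk
    simp
  · simp [hk]

theorem RunLE.outputsInTime [Fintype K] [∀ k, Fintype (Γ k)] {P : Prog Γ} {k₀ k₁ : K}
    {w : List (Γ k₀)} {o : List (Γ k₁)} {t : ℕ}
    (h : RunLE P (Function.update (fun _ => []) k₀ w) (Function.update (fun _ => []) k₁ o) t) :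
    Nonempty (Turing.TM2OutputsInTime (P.machine k₀ k₁) w (some o) (t + 1)) := by
  obtain ⟨n, hn, h⟩ := h
  obtain ⟨v, hv⟩ := h.stepsTo (M := (P.machine k₀ k₁).m) some none (fun _ => rfl) fun _ => none
  -- One extra step at the exit label resets the memory, because `Turing.haltList` prescribes the
  -- initial state.
  have hv' := hv.trans (StepsTo.single (c' := ⟨none, fun _ => none, _⟩)
    (by simp [Turing.TM2.step, machine]; rfl))
  refine ⟨⟨⟨n + 1, ?_⟩, Nat.add_le_add_right hn 1⟩⟩
  have h₀ : Turing.initList (P.machine k₀ k₁) w =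
      ⟨some (some P.entry), fun _ => none, Function.update (fun _ => []) k₀ w⟩ :=
    congrArg (Turing.TM2.Cfg.mk (some (some P.entry)) fun _ => none) (dite_eq_update k₀ w)
  have h₁ : Turing.haltList (P.machine k₀ k₁) o =
      ⟨none, fun _ => none, Function.update (fun _ => []) k₁ o⟩ :=
    congrArg (Turing.TM2.Cfg.mk none fun _ => none) (dite_eq_update k₁ o)
  refine Eq.trans ?_ (Eq.trans hv' (congrArg some h₁.symm))
  exact congrArg (fun c => (flip bind (P.machine k₀ k₁).step)^[n + 1] (some c)) h₀

end Prog

end PolyTime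

/-! ### Data as binary trees, stored on stacks in prefix notation -/

namespace PolyTime

open Prog

/-- Binary trees, the universal data type. -/
inductive Tree : Type
  | leaf : Tree
  | node (a b : Tree) : Tree

/-- Prefix notation of a tree. -/
def Tree.word : Tree → List Bool
  | leaf => [false]
  | node a b => true :: (a.word ++ b.word)

/-- The stacks of the machines considered here. -/
inductive Reg : Type
  | main | save | aux | cnt | inp | out
  deriving DecidableEq

instance : Fintype Reg where
  elems := {.main, .save, .aux, .cnt, .inp, .out}
  complete k := by cases k <;> simp

/-- The stack alphabets. -/
@[reducible] def Alph : Reg → Type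
  | .main => Bool
  | .save => Bool
  | .aux => Bool
  | .cnt => Bool
  | .inp => Computability.Γ'
  | .out => Bool

instance : (k : Reg) → Fintype (Alph k)
  | .main => inferInstanceAs (Fintype Bool)
  | .save => inferInstanceAs (Fintype Bool)
  | .aux => inferInstanceAs (Fintype Bool)
  | .cnt => inferInstanceAs (Fintype Bool)
  | .inp => inferInstanceAs (Fintype Computability.Γ')
  | .out => inferInstanceAs (Fintype Bool)

/-- The stacks with given contents. -/
def st (m s a c : List Bool) (i : List Computability.Γ') (o : List Bool) : ∀ k, List (Alph k)
  | .main => m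
  | .save => s
  | .aux => a
  | .cnt => c
  | .inp => i
  | .out => o

section Steps

variable (m s a c : List Bool) (i : List Computability.Γ') (o : List Bool)

@[simp] theorem update_st_main (x : List Bool) :
    Function.update (st m s a c i o) .main x = st x s a c i o := by
  funext k; cases k <;> rfl

@[simp] theorem update_st_save (x : List Bool) :
    Function.update (st m s a c i o) .save x = st m x a c i o := by
  funext k; cases k <;> rfl

@[simp] theorem update_st_aux (x : List Bool) :
    Function.update (st m s a c i o) .aux x = st m s x c i o := by
  funext k; cases k <;> rfl

@[simp] theorem update_st_cnt (x : List Bool) :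
    Function.update (st m s a c i o) .cnt x = st m s a x i o := by
  funext k; cases k <;> rfl

@[simp] theorem update_st_inp (x : List Computability.Γ') :
    Function.update (st m s a c i o) .inp x = st m s a c x o := by
  funext k; cases k <;> rfl

@[simp] theorem update_st_out (x : List Bool) :
    Function.update (st m s a c i o) .out x = st m s a c i x := by
  funext k; cases k <;> rfl

variable {m s a c i o}

theorem run_push_main (b : Bool) :
    RunLE (push .main b) (st m s a c i o) (st (b :: m) s a c i o) 1 := by
  simpa using! runLE_push (Γ := Alph) .main b (st m s a c i o)

theorem run_push_save (b : Bool) :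
    RunLE (push .save b) (st m s a c i o) (st m (b :: s) a c i o) 1 := by
  simpa using! runLE_push (Γ := Alph) .save b (st m s a c i o)

theorem run_push_aux (b : Bool) :
    RunLE (push .aux b) (st m s a c i o) (st m s (b :: a) c i o) 1 := by
  simpa using! runLE_push (Γ := Alph) .aux b (st m s a c i o)

theorem run_push_cnt (b : Bool) :
    RunLE (push .cnt b) (st m s a c i o) (st m s a (b :: c) i o) 1 := by
  simpa using! runLE_push (Γ := Alph) .cnt b (st m s a c i o)

theorem run_push_out (b : Bool) :
    RunLE (push .out b) (st m s a c i o) (st m s a c i (b :: o)) 1 := by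
  simpa using! runLE_push (Γ := Alph) .out b (st m s a c i o)

theorem run_cond_main {b : Bool} {P : Option Bool → Prog Alph} {S : ∀ k, List (Alph k)} {t : ℕ}
    (h : RunLE (P (some b)) (st m s a c i o) S t) :
    RunLE (cond .main P) (st (b :: m) s a c i o) S (t + 1) := by
  apply RunLE.cond
  simpa [st] using! h

theorem run_cond_save {b : Bool} {P : Option Bool → Prog Alph} {S : ∀ k, List (Alph k)} {t : ℕ}
    (h : RunLE (P (some b)) (st m s a c i o) S t) :
    RunLE (cond .save P) (st m (b :: s) a c i o) S (t + 1) := by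
  apply RunLE.cond
  simpa [st] using! h

theorem run_loop_aux {b : Bool} {P : Bool → Prog Alph} {S S' : ∀ k, List (Alph k)} {t t' : ℕ}
    (h : RunLE (P b) (st m s a c i o) S t) (h' : RunLE (loop .aux P) S S' t') :
    RunLE (loop .aux P) (st m s (b :: a) c i o) S' (t + t' + 1) := by
  refine RunLE.loop_cons (a := b) (l := a) rfl ?_ h'
  simpa using! h

theorem run_loop_cnt {b : Bool} {P : Bool → Prog Alph} {S S' : ∀ k, List (Alph k)} {t t' : ℕ}
    (h : RunLE (P b) (st m s a c i o) S t) (h' : RunLE (loop .cnt P) S S' t') :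
    RunLE (loop .cnt P) (st m s a (b :: c) i o) S' (t + t' + 1) := by
  refine RunLE.loop_cons (a := b) (l := c) rfl ?_ h'
  simpa using! h

theorem run_loop_inp {b : Computability.Γ'} {P : Computability.Γ' → Prog Alph}
    {S S' : ∀ k, List (Alph k)} {t t' : ℕ}
    (h : RunLE (P b) (st m s a c i o) S t) (h' : RunLE (loop .inp P) S S' t') :
    RunLE (loop .inp P) (st m s a c (b :: i) o) S' (t + t' + 1) := by
  refine RunLE.loop_cons (a := b) (l := i) rfl ?_ h'
  simpa using! h

end Steps

/-! ### Moving trees between stacks -/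

/-- One step of the traversal of a tree, given its next symbol. -/
def grabStep : Option Bool → Prog Alph
  | some true => seq (push .aux true) (seq (push .cnt true) (push .cnt true))
  | some false => push .aux false
  | none => skip

/-- Move as many trees as there are marks on `cnt` from `main`, in reverse, to `aux`. -/
def grabMainLoop : Prog Alph := loop .cnt fun _ => cond .main grabStep

/-- Move as many trees as there are marks on `cnt` from `save`, in reverse, to `aux`. -/
def grabSaveLoop : Prog Alph := loop .cnt fun _ => cond .save grabStep

/-- The marks on `cnt` count the subtrees still to be read. A node uses up one mark and adds two, a
leaf uses up one, so the end of a tree is found without a separator. Stating the claim for an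
arbitrary continuation `h` lets the induction treat the two subtrees in succession. Each symbol
costs at most five steps: two pops and up to three pushes. -/
theorem run_grabMainLoop (x : Tree) {r s a c i o S t}
    (h : RunLE grabMainLoop (st r s (x.word.reverse ++ a) c i o) S t) :
    RunLE grabMainLoop (st (x.word ++ r) s a (true :: c) i o) S (t + 5 * x.word.length) := by
  induction x generalizing r a c t with
  | leaf =>
    exact (run_loop_cnt (run_cond_main (run_push_aux false)) h).mono (by simp [Tree.word]; omega)
  | node x y ihx ihy =>
    simp only [Tree.word, List.reverse_cons, List.reverse_append, List.append_assoc] at h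
    have h' : RunLE grabMainLoop (st ((x.word ++ y.word) ++ r) s (true :: a) (true :: true :: c) i o) S
        (t + 5 * y.word.length + 5 * x.word.length) := by
      simpa using ihx (ihy h)
    exact (run_loop_cnt (run_cond_main ((run_push_aux true).seq
      ((run_push_cnt true).seq (run_push_cnt true)))) h').mono (by simp [Tree.word]; omega)

theorem run_grabSaveLoop (x : Tree) {m r a c i o S t}
    (h : RunLE grabSaveLoop (st m r (x.word.reverse ++ a) c i o) S t) :
    RunLE grabSaveLoop (st m (x.word ++ r) a (true :: c) i o) S (t + 5 * x.word.length) := by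
  induction x generalizing r a c t with
  | leaf =>
    exact (run_loop_cnt (run_cond_save (run_push_aux false)) h).mono (by simp [Tree.word]; omega)
  | node x y ihx ihy =>
    simp only [Tree.word, List.reverse_cons, List.reverse_append, List.append_assoc] at h
    have h' : RunLE grabSaveLoop (st m ((x.word ++ y.word) ++ r) (true :: a) (true :: true :: c) i o) S
        (t + 5 * y.word.length + 5 * x.word.length) := by
      simpa using ihx (ihy h)
    exact (run_loop_cnt (run_cond_save ((run_push_aux true).seq
      ((run_push_cnt true).seq (run_push_cnt true)))) h').mono (by simp [Tree.word]; omega)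

/-- Move a tree from `main`, in reverse, to `aux`. -/
def grabMain : Prog Alph := seq (push .cnt true) grabMainLoop

/-- Move a tree from `save`, in reverse, to `aux`. -/
def grabSave : Prog Alph := seq (push .cnt true) grabSaveLoop

theorem run_grabMain (x : Tree) {r s a i o} :
    RunLE grabMain (st (x.word ++ r) s a [] i o) (st r s (x.word.reverse ++ a) [] i o)
      (5 * x.word.length + 2) :=
  ((run_push_cnt true).seq (run_grabMainLoop x (runLE_loop_nil _ rfl))).mono (by omega)

theorem run_grabSave (x : Tree) {m r a i o} :
    RunLE grabSave (st m (x.word ++ r) a [] i o) (st m r (x.word.reverse ++ a) [] i o)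
      (5 * x.word.length + 2) :=
  ((run_push_cnt true).seq (run_grabSaveLoop x (runLE_loop_nil _ rfl))).mono (by omega)

/-- Empty `aux` onto `main` (if `p`) and onto `save` (if `q`). -/
def unload (p q : Bool) : Prog Alph :=
  loop .aux fun b => seq (if p then push .main b else skip) (if q then push .save b else skip)

/-- The word on `aux` is reversed, and popping it reverses it again; so a grab followed by an unload
preserves the order, at a total of at most eight steps per symbol. -/
theorem run_unload (p q : Bool) (l : List Bool) {m s c i o} :
    RunLE (unload p q) (st m s l c i o)
      (st (if p then l.reverse ++ m else m) (if q then l.reverse ++ s else s) [] c i o)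
      (3 * l.length + 1) := by
  induction l generalizing m s with
  | nil =>
    simp only [List.reverse_nil, List.nil_append, ite_self]
    exact runLE_loop_nil _ rfl
  | cons b l ih =>
    have h1 : RunLE (if p then push .main b else skip) (st m s l c i o)
        (st (if p then b :: m else m) s l c i o) 1 := by
      cases p
      · exact runLE_skip _
      · exact run_push_main b
    have h2 : RunLE (if q then push .save b else skip) (st (if p then b :: m else m) s l c i o)
        (st (if p then b :: m else m) (if q then b :: s else s) l c i o) 1 := by
      cases q
      · exact runLE_skip _
      · exact run_push_save b
    have h := run_loop_aux (h1.seq h2) ih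
    refine RunLE.mono (t := 1 + 1 + (3 * l.length + 1) + 1) ?_ (by simp; omega)
    cases p <;> cases q <;> simpa [unload] using h

/-- Copy the tree on `main` to `save`. -/
def copy : Prog Alph := seq grabMain (unload true true)

/-- Remove the tree on `main`. -/
def drop : Prog Alph := seq grabMain (unload false false)

/-- Move the tree on `main` to `save`. -/
def store : Prog Alph := seq grabMain (unload false true)

/-- Move the tree on `save` to `main`. -/
def restore : Prog Alph := seq grabSave (unload true false)

theorem run_copy (x : Tree) {r s i o} :
    RunLE copy (st (x.word ++ r) s [] [] i o) (st (x.word ++ r) (x.word ++ s) [] [] i o)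
      (8 * x.word.length + 3) := by
  have h := (run_grabMain x (r := r) (s := s) (a := []) (i := i) (o := o)).seq
    (run_unload true true _)
  simp at h
  exact h.mono (by omega)

theorem run_drop (x : Tree) {r s i o} :
    RunLE drop (st (x.word ++ r) s [] [] i o) (st r s [] [] i o) (8 * x.word.length + 3) := by
  have h := (run_grabMain x (r := r) (s := s) (a := []) (i := i) (o := o)).seq
    (run_unload false false _)
  simp at h
  exact h.mono (by omega)

theorem run_store (x : Tree) {r s i o} :
    RunLE store (st (x.word ++ r) s [] [] i o) (st r (x.word ++ s) [] [] i o)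
      (8 * x.word.length + 3) := by
  have h := (run_grabMain x (r := r) (s := s) (a := []) (i := i) (o := o)).seq
    (run_unload false true _)
  simp at h
  exact h.mono (by omega)

theorem run_restore (x : Tree) {m r i o} :
    RunLE restore (st m (x.word ++ r) [] [] i o) (st (x.word ++ m) r [] [] i o)
      (8 * x.word.length + 3) := by
  have h := (run_grabSave x (m := m) (r := r) (a := []) (i := i) (o := o)).seq
    (run_unload true false _)
  simp at h
  exact h.mono (by omega)

/-- Push a word onto `main`. -/
def pushWord : List Bool → Prog Alph
  | [] => skip
  | b :: w => seq (pushWord w) (push .main b)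

theorem run_pushWord (w : List Bool) {m s a c i o} :
    RunLE (pushWord w) (st m s a c i o) (st (w ++ m) s a c i o) (w.length + 1) := by
  induction w with
  | nil => exact runLE_skip _
  | cons b w ih => exact ih.seq (run_push_main b)

end PolyTime

/-! ### Functions computable in polynomial time -/

namespace PolyTime

open Prog

/-- Types whose elements are represented by trees. -/
class Enc (α : Type) where
  tree : α → Tree

/-- The word that represents `a` on the stacks. -/
def code {α : Type} [Enc α] (a : α) : List Bool := (Enc.tree a).word

/-- The length of the code of `a`. -/
def size {α : Type} [Enc α] (a : α) : ℕ := (code a).length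

instance : Enc Bool where
  tree b := if b then .node .leaf .leaf else .leaf

instance {α β : Type} [Enc α] [Enc β] : Enc (α × β) where
  tree p := .node (Enc.tree p.1) (Enc.tree p.2)

/-- The tree of a list. -/
def listTree {α : Type} [Enc α] : List α → Tree
  | [] => .leaf
  | a :: l => .node (Enc.tree a) (listTree l)

instance {α : Type} [Enc α] : Enc (List α) where
  tree := listTree

section

variable {α β γ δ σ : Type} [Enc α] [Enc β] [Enc γ] [Enc δ] [Enc σ]

theorem code_true : code true = [true, false, false] := rfl

theorem code_false : code false = [false] := rfl

theorem code_pair (a : α) (b : β) : code (a, b) = true :: (code a ++ code b) := rfl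

theorem code_nil : code ([] : List α) = [false] := rfl

theorem code_cons (a : α) (l : List α) : code (a :: l) = true :: (code a ++ code l) := rfl

theorem size_bool_le (b : Bool) : size b ≤ 3 := by
  cases b <;> simp [size, code_true, code_false]

@[simp] theorem size_pair (a : α) (b : β) : size (a, b) = size a + size b + 1 := by
  simp [size, code_pair]

@[simp] theorem size_nil : size ([] : List α) = 1 := rfl

@[simp] theorem size_cons (a : α) (l : List α) : size (a :: l) = size a + size l + 1 := by
  simp [size, code_cons]

theorem one_le_size (a : α) : 1 ≤ size a := by
  simp only [size, code]
  cases Enc.tree a <;> simp [Tree.word]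

theorem size_le_of_mem {a : α} {l : List α} (h : a ∈ l) : size a ≤ size l := by
  induction l with
  | nil => simp at h
  | cons b l ih =>
    rcases List.mem_cons.1 h with rfl | h
    · simp; omega
    · have := ih h
      simp; omega

theorem length_le_size (l : List α) : l.length ≤ size l := by
  induction l with
  | nil => simp
  | cons b l ih => simp; omega

@[simp] theorem size_append (l l' : List α) : size (l ++ l') + 1 = size l + size l' := by
  induction l with
  | nil => simp; omega
  | cons b l ih => simp; omega

/-! #### Polynomial bounds -/

theorem eval_monotone (P : Polynomial ℕ) : Monotone fun n => P.eval n := by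
  intro m n h
  simp only [Polynomial.eval_eq_sum_range]
  gcongr

/-- `t` is bounded by a polynomial in the size of its argument. -/
def PolyBdd (t : α → ℕ) : Prop := ∃ P : Polynomial ℕ, ∀ a, t a ≤ P.eval (size a)

theorem PolyBdd.mono {t t' : α → ℕ} (h : PolyBdd t') (ht : ∀ a, t a ≤ t' a) : PolyBdd t := by
  obtain ⟨P, hP⟩ := h
  exact ⟨P, fun a => (ht a).trans (hP a)⟩

theorem PolyBdd.const (n : ℕ) : PolyBdd fun _ : α => n :=
  ⟨Polynomial.C n, fun a => by simp⟩

theorem polyBdd_size : PolyBdd fun a : α => size a := ⟨Polynomial.X, fun a => by simp⟩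

theorem PolyBdd.add {t t' : α → ℕ} (h : PolyBdd t) (h' : PolyBdd t') :
    PolyBdd fun a => t a + t' a := by
  obtain ⟨P, hP⟩ := h
  obtain ⟨Q, hQ⟩ := h'
  exact ⟨P + Q, fun a => by simpa using Nat.add_le_add (hP a) (hQ a)⟩

theorem PolyBdd.mul {t t' : α → ℕ} (h : PolyBdd t) (h' : PolyBdd t') :
    PolyBdd fun a => t a * t' a := by
  obtain ⟨P, hP⟩ := h
  obtain ⟨Q, hQ⟩ := h'
  exact ⟨P * Q, fun a => by simpa using Nat.mul_le_mul (hP a) (hQ a)⟩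

theorem PolyBdd.eval {t : α → ℕ} (h : PolyBdd t) (P : Polynomial ℕ) :
    PolyBdd fun a => P.eval (t a) := by
  obtain ⟨Q, hQ⟩ := h
  exact ⟨P.comp Q, fun a => by simpa using eval_monotone P (hQ a)⟩

theorem PolyBdd.comp {t : β → ℕ} (h : PolyBdd t) {f : α → β} (hf : PolyBdd fun a => size (f a)) :
    PolyBdd fun a => t (f a) := by
  obtain ⟨P, hP⟩ := h
  exact (hf.eval P).mono fun a => hP _

/-! #### The class of functions -/

/-- The stacks between the execution of subprograms. -/
abbrev conf (m s : List Bool) : ∀ k, List (Alph k) := st m s [] [] [] []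

/-- `f` is computed in polynomial time by a program that replaces the code of its argument on
`main` by the code of its value. -/
def Poly (f : α → β) : Prop :=
  PolyBdd (fun a => size (f a)) ∧ ∃ (p : Prog Alph) (t : α → ℕ), PolyBdd t ∧
    ∀ a r s, RunLE p (conf (code a ++ r) s) (conf (code (f a) ++ r) s) (t a)

theorem copy_code (a : α) (r s : List Bool) :
    RunLE copy (conf (code a ++ r) s) (conf (code a ++ r) (code a ++ s)) (8 * size a + 3) :=
  run_copy (Enc.tree a)

theorem drop_code (a : α) (r s : List Bool) :
    RunLE drop (conf (code a ++ r) s) (conf r s) (8 * size a + 3) :=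
  run_drop (Enc.tree a)

theorem store_code (a : α) (r s : List Bool) :
    RunLE store (conf (code a ++ r) s) (conf r (code a ++ s)) (8 * size a + 3) :=
  run_store (Enc.tree a)

theorem restore_code (a : α) (r s : List Bool) :
    RunLE restore (conf r (code a ++ s)) (conf (code a ++ r) s) (8 * size a + 3) :=
  run_restore (Enc.tree a)

/-- Programs only see trees, so a change of type that keeps the tree costs nothing. For example, a
pair `(b, l)` and the list `b :: l` have the same tree. -/
theorem Poly.of_tree_eq {f : α → β} (hf : Poly f) {g : α → γ}
    (h : ∀ a, Enc.tree (g a) = Enc.tree (f a)) : Poly g := by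
  obtain ⟨h1, p, t, ht, hp⟩ := hf
  refine ⟨?_, p, t, ht, ?_⟩ <;> simpa only [size, code, h] using ‹_›

theorem Poly.id : Poly fun a : α => a :=
  ⟨polyBdd_size, skip, fun _ => 1, .const 1, fun _ _ _ => runLE_skip _⟩

/-- The size bound contained in `Poly` is used here: the second program runs in time polynomial in
`size (f a)`, which is polynomial in `size a`. -/
theorem Poly.comp {g : β → γ} {f : α → β} (hg : Poly g) (hf : Poly f) : Poly fun a => g (f a) := by
  obtain ⟨h1, p, t, ht, hp⟩ := hf
  obtain ⟨h2, q, u, hu, hq⟩ := hg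
  exact ⟨h2.comp h1, seq p q, _, ht.add (hu.comp h1), fun a r s => (hp a r s).seq (hq (f a) r s)⟩

theorem Poly.const (b : β) : Poly fun _ : α => b := by
  refine ⟨.const _, seq drop (pushWord (code b)), fun a => 8 * size a + 3 + (size b + 1),
    (((PolyBdd.const 8).mul polyBdd_size).add (.const 3)).add (.const _), fun a r s => ?_⟩
  exact (drop_code a r s).seq (run_pushWord _)

theorem Poly.pair {f : α → β} {g : α → γ} (hf : Poly f) (hg : Poly g) :
    Poly fun a => (f a, g a) := by
  obtain ⟨h1, p, t, ht, hp⟩ := hf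
  obtain ⟨h2, q, u, hu, hq⟩ := hg
  refine ⟨((h1.add h2).add (.const 1)).mono fun a => by simp,
    -- In prefix notation the first component lies on top, so `g` is evaluated first, and `f`
    -- afterwards on the saved copy of the argument.
    seq copy (seq q (seq restore (seq p (push .main true)))),
    fun a => (8 * size a + 3) + (u a + ((8 * size a + 3) + (t a + 1))), ?_, fun a r s => ?_⟩
  · have h8 : PolyBdd fun a : α => 8 * size a + 3 :=
      ((PolyBdd.const 8).mul polyBdd_size).add (.const 3)
    exact h8.add (hu.add (h8.add (ht.add (.const 1))))
  · have h := (copy_code a r s).seq ((hq a r (code a ++ s)).seq ((restore_code a _ s).seq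
      ((hp a (code (g a) ++ r) s).seq (run_push_main true))))
    simpa only [conf, code_pair, List.cons_append, List.append_assoc] using h

theorem Poly.fst : Poly fun p : α × β => p.1 := by
  refine ⟨polyBdd_size.mono fun p => by rcases p with ⟨a, b⟩; simp; omega,
    cond .main fun _ => seq store (seq drop restore), fun p => 24 * size p + 10,
    ((PolyBdd.const 24).mul polyBdd_size).add (.const 10), fun ⟨a, b⟩ r s => ?_⟩
  have h := run_cond_main (b := true) (P := fun _ => seq store (seq drop restore))
    ((store_code a (code b ++ r) s).seq ((drop_code b _ _).seq (restore_code a _ _)))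
  rw [code_pair, List.cons_append, List.append_assoc]
  exact h.mono (by simp only [size_pair]; omega)

theorem Poly.snd : Poly fun p : α × β => p.2 := by
  refine ⟨polyBdd_size.mono fun p => by rcases p with ⟨a, b⟩; simp; omega,
    cond .main fun _ => drop, fun p => 24 * size p + 10,
    ((PolyBdd.const 24).mul polyBdd_size).add (.const 10), fun ⟨a, b⟩ r s => ?_⟩
  have h := run_cond_main (b := true) (P := fun _ => drop)
    (drop_code a (code b ++ r) s)
  rw [code_pair, List.cons_append, List.append_assoc]
  exact h.mono (by simp only [size_pair]; omega)

theorem Poly.ite {c : α → Bool} {f g : α → β} (hc : Poly c) (hf : Poly f) (hg : Poly g) :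
    Poly fun a => if c a then f a else g a := by
  obtain ⟨-, z, v, hv, hz⟩ := hc
  obtain ⟨h1, p, t, ht, hp⟩ := hf
  obtain ⟨h2, q, u, hu, hq⟩ := hg
  refine ⟨(h1.add h2).mono fun a => by dsimp only; split_ifs <;> omega,
    -- The code of `true` has three symbols, that of `false` only one; in the first case two more
    -- symbols are removed.
    seq copy (seq z (cond .main fun b => if b = some true
      then cond .main fun _ => cond .main fun _ => seq restore p else seq restore q)),
    fun a => (8 * size a + 3) + (v a + ((8 * size a + 3) + t a + u a + 3)), ?_, fun a r s => ?_⟩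
  · have h8 : PolyBdd fun a : α => 8 * size a + 3 :=
      ((PolyBdd.const 8).mul polyBdd_size).add (.const 3)
    exact h8.add (hv.add (((h8.add ht).add hu).add (.const 3)))
  · refine (copy_code a r s).seq ((hz a r (code a ++ s)).seq ?_)
    rcases hca : c a
    · simp only [hca, Bool.false_eq_true, if_false]
      have h := (restore_code a r s).seq (hq a r s)
      exact RunLE.mono (run_cond_main (b := false) h) (by omega)
    · simp only [hca, if_true]
      have h := run_cond_main (b := false) (P := fun _ => cond .main fun _ => seq restore p)
        (run_cond_main (b := false) (P := fun _ => seq restore p)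
          ((restore_code a r s).seq (hp a r s)))
      exact RunLE.mono (run_cond_main (b := true) h) (by omega)

theorem Poly.list_cases {f : α → List β} {g : α → γ} {h : α → β → List β → γ} (hf : Poly f)
    (hg : Poly g) (hh : Poly fun x : α × β × List β => h x.1 x.2.1 x.2.2) :
    Poly fun a => (match f a with
      | [] => g a
      | b :: l => h a b l : γ) := by
  obtain ⟨h0, z, v, hv, hz⟩ := hf
  obtain ⟨h1, p, t, ht, hp⟩ := hg
  obtain ⟨h2, q, u, hu, hq⟩ := hh
  have hs : PolyBdd fun a => size a + size (f a) + 1 := (polyBdd_size.add h0).add (.const 1)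
  obtain ⟨U, hU⟩ := hu
  obtain ⟨W, hW⟩ := h2
  refine ⟨(h1.add (hs.eval W)).mono fun a => ?_,
    -- The popped `true` is pushed back, which turns `b :: l` into the pair `(b, l)`. Another `true`
    -- on top of the restored `a` completes the triple `(a, b, l)`.
    seq copy (seq z (cond .main fun b => if b = some true
      then seq (push .main true) (seq restore (seq (push .main true) q)) else seq restore p)),
    fun a => (8 * size a + 3) + (v a + ((8 * size a + 3) + t a +
      U.eval (size a + size (f a) + 1) + 3)), ?_, fun a r s => ?_⟩
  · rcases hfa : f a with _ | ⟨b, l⟩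
    · simp only [hfa]
      omega
    · simp only [hfa]
      exact le_add_of_le_right ((hW (a, b, l)).trans (eval_monotone W (by simp)))
  · have h8 : PolyBdd fun a : α => 8 * size a + 3 :=
      ((PolyBdd.const 8).mul polyBdd_size).add (.const 3)
    exact h8.add (hv.add (((h8.add ht).add (hs.eval U)).add (.const 3)))
  · refine (copy_code a r s).seq ((hz a r (code a ++ s)).seq ?_)
    rcases hfa : f a with _ | ⟨b, l⟩
    · simp only [hfa]
      have h := (restore_code a r s).seq (hp a r s)
      exact RunLE.mono (run_cond_main (b := false) h) (by omega)
    · have hq' := hq (a, b, l) r s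
      have hU' : u (a, b, l) ≤ U.eval (size a + size (b :: l) + 1) :=
        (hU (a, b, l)).trans (eval_monotone U (by simp))
      simp only [code_pair, List.cons_append, List.append_assoc] at hq'
      simp only [hfa, code_cons, List.cons_append, List.append_assoc]
      have h := (run_push_main true).seq ((restore_code a _ s).seq ((run_push_main true).seq hq'))
      exact RunLE.mono (run_cond_main (b := true) h) (by omega)

end

end PolyTime

namespace PolyTime

open Prog

section

variable {α β γ δ σ : Type} [Enc α] [Enc β] [Enc γ] [Enc δ] [Enc σ]

/-! #### Folding over lists -/

/-- The main loop of a fold: with a state and a list on `main`, run `q` on the state and each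
element of the list. -/
def foldLoop (q : Prog Alph) : Prog Alph :=
  loop .cnt fun _ => seq grabMain (cond .main fun b => if b = some true
    then seq (unload true false) (seq (push .main true) (seq q (push .cnt true)))
    else unload true false)

/-- The state lies above the remaining list. Each round moves the state to `aux` to expose the first
symbol of the list: after `true` the state goes back on top, forming a pair with the next element
for `q`; after `false` the list has ended. The mark on `cnt` serves as the flag "go on" and is off
the stack while `q` runs. `C` and `D` bound the times and state sizes that occur on this list only.
-/
theorem run_foldLoop {F : σ → β → σ} {q : Prog Alph} {t : σ → β → ℕ}
    (hq : ∀ x b r v, RunLE q (conf (code (x, b) ++ r) v) (conf (code (F x b) ++ r) v) (t x b))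
    {C D : ℕ} (l : List β) (x : σ) (r v : List Bool)
    (hC : ∀ l₁ b l₂, l = l₁ ++ b :: l₂ → t (l₁.foldl F x) b ≤ C)
    (hD : ∀ l₁, l₁ <+: l → size (l₁.foldl F x) ≤ D) :
    RunLE (foldLoop q) (st (code x ++ (code l ++ r)) v [] [true] [] [])
      (conf (code (l.foldl F x) ++ r) v) ((l.length + 1) * (8 * D + C + 12)) := by
  have hx : size x ≤ D := hD [] (List.nil_prefix)
  have hu (m : List Bool) : RunLE (unload true false) (st m v (code x).reverse [] [] [])
      (conf (code x ++ m) v) (3 * size x + 1) := by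
    have := run_unload true false (code x).reverse (m := m) (s := v) (c := []) (i := []) (o := [])
    simpa [size] using this
  induction l generalizing x with
  | nil =>
    have h := (run_grabMain (Enc.tree x) (r := false :: r) (s := v) (a := []) (i := [])
      (o := [])).seq (run_cond_main (b := false) (P := fun b => if b = some true
        then seq (unload true false) (seq (push .main true) (seq q (push .cnt true)))
        else unload true false) (by simpa [code] using hu r))
    refine RunLE.mono (run_loop_cnt h (runLE_loop_nil _ rfl)) ?_
    simp only [List.length_nil, size, code] at *
    omega
  | cons b l ih =>
    have ht : t x b ≤ C := hC [] b l rfl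
    have hF : size (F x b) ≤ D := hD [b] (by simp)
    have h1 := ih (F x b) (fun l₁ c l₂ h => hC (b :: l₁) c l₂ (by simp [h]))
      (fun l₁ h => hD (b :: l₁) (by simpa using h)) hF fun m => by
        have := run_unload true false (code (F x b)).reverse (m := m) (s := v) (c := [])
          (i := []) (o := [])
        simpa [size] using this
    have hq' := hq x b (code l ++ r) v
    simp only [code_pair, List.cons_append, List.append_assoc] at hq'
    have h2 := (hu (code b ++ (code l ++ r))).seq ((run_push_main true).seq
      (hq'.seq (run_push_cnt true)))
    have h3 := (run_grabMain (Enc.tree x) (r := true :: (code b ++ (code l ++ r))) (s := v)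
      (a := []) (i := []) (o := [])).seq (run_cond_main (b := true) (P := fun b => if b = some true
        then seq (unload true false) (seq (push .main true) (seq q (push .cnt true)))
        else unload true false) (by simpa [code] using h2))
    have h4 := run_loop_cnt (b := true) h3 h1
    rw [code_cons, List.cons_append, List.append_assoc]
    refine RunLE.mono h4 ?_
    simp only [List.length_cons, size, code] at *
    rw [add_mul (l.length + 1)]
    omega

/-- A polynomial-time step alone is not enough, because the state might, say, double in every round.
Hence the assumption of a polynomial bound `D` on the states reached along all prefixes. -/
theorem Poly.foldl_of_bound {f : α → List β} {g : α → σ} {h : α → σ → β → σ} (hf : Poly f)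
    (hg : Poly g) (hh : Poly fun x : α × σ × β => h x.1 x.2.1 x.2.2) {D : α → ℕ} (hD : PolyBdd D)
    (hb : ∀ a l, l <+: f a → size (l.foldl (h a) (g a)) ≤ D a) :
    Poly fun a => (f a).foldl (h a) (g a) := by
  -- The loop body sees only the state and one element, so the parameter `a` is carried along inside
  -- the state.
  have hF : Poly fun x : (α × σ) × β => (x.1.1, h x.1.1 x.1.2 x.2) :=
    .pair (.comp .fst .fst) (hh.comp (.pair (.comp .fst .fst) (.pair (.comp .snd .fst) .snd)))
  obtain ⟨hs₀, p, t, ht, hp⟩ := Poly.pair (Poly.pair .id hg) hf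
  obtain ⟨-, q, u, ⟨U, hU⟩, hq⟩ := hF
  obtain ⟨-, z, w, ⟨W, hW⟩, hz⟩ := Poly.snd (α := α) (β := σ)
  have hfold (a : α) (l : List β) (x : σ) :
      l.foldl (fun y b => (y.1, h y.1 y.2 b)) (a, x) = (a, l.foldl (h a) x) := by
    induction l generalizing x with
    | nil => rfl
    | cons b l ih => simp [ih]
  have hE : PolyBdd fun a => size a + D a + 1 := (polyBdd_size.add hD).add (.const 1)
  have hC : PolyBdd fun a => U.eval (size a + D a + 1 + size (f a) + 1) :=
    ((hE.add hf.1).add (.const 1)).eval U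
  refine ⟨hD.mono fun a => hb a _ List.prefix_rfl,
    seq p (seq (cond .main fun _ => seq (push .cnt true) (foldLoop q)) z),
    fun a => t a + ((1 + ((size (f a) + 1) * (8 * (size a + D a + 1) +
      U.eval (size a + D a + 1 + size (f a) + 1) + 12)) + 1) + W.eval (size a + D a + 1)),
    ?_, fun a r v => ?_⟩
  · exact ht.add ((((PolyBdd.const 1).add ((hf.1.add (.const 1)).mul
      ((((PolyBdd.const 8).mul hE).add hC).add (.const 12)))).add (.const 1)).add (hE.eval W))
  · have h1 := hp a r v
    have hbound (l : List β) (hl : l <+: f a) :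
        size (l.foldl (fun y b => (y.1, h y.1 y.2 b)) (a, g a)) ≤ size a + D a + 1 := by
      have := hb a l hl
      rw [hfold, size_pair]
      omega
    have h2 := run_foldLoop (F := fun (y : α × σ) b => (y.1, h y.1 y.2 b)) (q := q)
      (t := fun y b => u (y, b)) (fun y b => hq (y, b)) (f a) (a, g a) r v
      (C := U.eval (size a + D a + 1 + size (f a) + 1)) (fun l₁ b l₂ hl => by
        refine (hU _).trans (eval_monotone U ?_)
        have h1 := hbound l₁ ⟨b :: l₂, hl.symm⟩
        have h2 := size_le_of_mem (show b ∈ f a by simp [hl])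
        rw [size_pair]
        omega) hbound
    have h3 := run_cond_main (b := true) (P := fun _ => seq (push .cnt true) (foldLoop q))
      ((run_push_cnt true).seq h2)
    have h4 := hz ((f a).foldl (fun y b => (y.1, h y.1 y.2 b)) (a, g a)) r v
    have h5 := h1.seq (S'' := conf (code ((f a).foldl (h a) (g a)) ++ r) v)
      (by simpa only [code_pair (a, g a), List.cons_append, List.append_assoc,
        show ((f a).foldl (fun y b => (y.1, h y.1 y.2 b)) (a, g a)).2 =
          (f a).foldl (h a) (g a) from congrArg Prod.snd (hfold _ _ _)] using h3.seq h4)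
    refine h5.mono ?_
    have h6 := (hW ((f a).foldl (fun y b => (y.1, h y.1 y.2 b)) (a, g a))).trans
      (eval_monotone W (hbound _ List.prefix_rfl))
    have h7 : ((f a).length + 1) * (8 * (size a + D a + 1) +
      U.eval (size a + D a + 1 + size (f a) + 1) + 12) ≤ (size (f a) + 1) *
      (8 * (size a + D a + 1) + U.eval (size a + D a + 1 + size (f a) + 1) + 12) :=
      Nat.mul_le_mul_right _ (Nat.add_le_add_right (length_le_size _) 1)
    rw [hfold] at h6
    simp only [hfold]
    simp only at h6
    omega

/-- Folds whose state grows by a polynomially bounded amount in each step. -/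
theorem Poly.foldl {f : α → List β} {g : α → σ} {h : α → σ → β → σ} (hf : Poly f)
    (hg : Poly g) (hh : Poly fun x : α × σ × β => h x.1 x.2.1 x.2.2) {D : α → ℕ} (hD : PolyBdd D)
    (hb : ∀ a x, ∀ b ∈ f a, size (h a x b) ≤ size x + D a) :
    Poly fun a => (f a).foldl (h a) (g a) := by
  refine hf.foldl_of_bound hg hh (D := fun a => size (g a) + size (f a) * D a)
    (hg.1.add (hf.1.mul hD)) fun a l hl => ?_
  have key (l : List β) (x : σ) (hl : ∀ b ∈ l, b ∈ f a) :
      size (l.foldl (h a) x) ≤ size x + l.length * D a := by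
    induction l generalizing x with
    | nil => simp
    | cons b l ih =>
      have h1 := ih (h a x b) fun c hc => hl c (List.mem_cons_of_mem _ hc)
      have h2 := hb a x b (hl b List.mem_cons_self)
      simp only [List.foldl_cons, List.length_cons, add_mul]
      omega
  refine (key l _ fun b hb => hl.subset hb).trans (Nat.add_le_add_left ?_ _)
  exact Nat.mul_le_mul_right _ (hl.length_le.trans (length_le_size _))

end

end PolyTime

namespace PolyTime

section

variable {α β γ δ σ : Type} [Enc α] [Enc β] [Enc γ] [Enc δ] [Enc σ]

/-! #### Lists and truth values -/

attribute [fun_prop] Poly Poly.id Poly.const Poly.comp Poly.pair Poly.ite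

@[fun_prop] theorem Poly.fst' {f : α → β × γ} (hf : Poly f) : Poly fun a => (f a).1 :=
  Poly.fst.comp hf

@[fun_prop] theorem Poly.snd' {f : α → β × γ} (hf : Poly f) : Poly fun a => (f a).2 :=
  Poly.snd.comp hf

@[fun_prop] theorem Poly.cons {f : α → β} {g : α → List β} (hf : Poly f) (hg : Poly g) :
    Poly fun a => f a :: g a := (Poly.pair hf hg).of_tree_eq fun _ => rfl

@[fun_prop] theorem Poly.tail {f : α → List β} (hf : Poly f) : Poly fun a => (f a).tail := by
  have h := hf.list_cases (g := fun _ => []) (h := fun _ _ l => l) (.const _) (by fun_prop)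
  convert h using 2 with a
  cases f a <;> rfl

@[fun_prop] theorem Poly.headD {f : α → List β} {g : α → β} (hf : Poly f) (hg : Poly g) :
    Poly fun a => (f a).headD (g a) := by
  have h := hf.list_cases (g := g) (h := fun _ b _ => b) hg (by fun_prop)
  convert h using 2 with a
  cases f a <;> rfl

@[fun_prop] theorem Poly.isEmpty {f : α → List β} (hf : Poly f) : Poly fun a => (f a).isEmpty := by
  have h := hf.list_cases (g := fun _ => true) (h := fun _ _ _ => false) (.const _) (.const _)
  convert h using 2 with a
  cases f a <;> rfl

@[fun_prop] theorem Poly.and {f g : α → Bool} (hf : Poly f) (hg : Poly g) :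
    Poly fun a => f a && g a := by
  have h := hf.ite hg (.const false)
  convert h using 2 with a
  cases f a <;> rfl

@[fun_prop] theorem Poly.or {f g : α → Bool} (hf : Poly f) (hg : Poly g) :
    Poly fun a => f a || g a := by
  have h := hf.ite (.const true) hg
  convert h using 2 with a
  cases f a <;> rfl

@[fun_prop] theorem Poly.not {f : α → Bool} (hf : Poly f) : Poly fun a => !f a := by
  have h := hf.ite (.const false) (.const true)
  convert h using 2 with a
  cases f a <;> rfl

@[fun_prop] theorem Poly.reverse {f : α → List β} (hf : Poly f) : Poly fun a => (f a).reverse := by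
  have h := hf.foldl (g := fun _ => []) (h := fun _ l b => b :: l) (.const _) (by fun_prop)
    (D := fun a => size (f a) + 1) (hf.1.add (.const 1)) fun a x b hb => by
      have := size_le_of_mem hb
      simp; omega
  convert h using 2 with a
  simp

theorem Poly.foldr {f : α → List β} {g : α → σ} {h : α → β → σ → σ} (hf : Poly f)
    (hg : Poly g) (hh : Poly fun x : α × β × σ => h x.1 x.2.1 x.2.2) {D : α → ℕ} (hD : PolyBdd D)
    (hb : ∀ a x, ∀ b ∈ f a, size (h a b x) ≤ size x + D a) :
    Poly fun a => (f a).foldr (h a) (g a) := by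
  have h1 := hf.reverse.foldl (g := g) (h := fun a x b => h a b x) hg
    (hh.comp (f := fun x : α × σ × β => (x.1, x.2.2, x.2.1)) (by fun_prop)) hD
    fun a x b hb' => hb a x b (List.mem_reverse.1 hb')
  simpa using h1

/-- Every element of `f a` is no larger than `f a`; this turns a bound in `(a, b)` into one in `a`
alone, as folds require. -/
theorem PolyBdd.of_mem {t : α × β → ℕ} (ht : PolyBdd t) {f : α → List β} (hf : Poly f) :
    ∃ D : α → ℕ, PolyBdd D ∧ ∀ a, ∀ b ∈ f a, t (a, b) ≤ D a := by
  obtain ⟨W, hW⟩ := ht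
  refine ⟨_, ((polyBdd_size.add hf.1).add (.const 1)).eval W, fun a b hb => (hW _).trans ?_⟩
  have := size_le_of_mem hb
  exact eval_monotone W (by simp; omega)

@[fun_prop] theorem Poly.append {f g : α → List β} (hf : Poly f) (hg : Poly g) :
    Poly fun a => f a ++ g a := by
  have h := hf.foldr (h := fun _ b l => b :: l) hg (by fun_prop)
    (D := fun a => size (f a) + 1) (hf.1.add (.const 1)) fun a x b hb => by
      have := size_le_of_mem hb
      simp; omega
  convert h using 2 with a
  simp

@[fun_prop] theorem Poly.flatMap {f : α → List β} {h : α → β → List γ} (hf : Poly f)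
    (hh : Poly fun x : α × β => h x.1 x.2) : Poly fun a => (f a).flatMap fun b => h a b := by
  obtain ⟨D, hD, hb⟩ := hh.1.of_mem hf
  have h := hf.foldr (g := fun _ => []) (h := fun a b l => h a b ++ l) (.const _)
    (.append (hh.comp (f := fun x : α × β × List γ => (x.1, x.2.1)) (by fun_prop)) (by fun_prop))
    hD fun a x b hb' => by
      have h1 := hb a b hb'
      have h2 := size_append (h a b) x
      simp only at h1
      omega
  convert h using 2 with a
  induction f a with
  | nil => rfl
  | cons b l ih => simp [ih]

@[fun_prop] theorem Poly.map {f : α → List β} {h : α → β → γ} (hf : Poly f)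
    (hh : Poly fun x : α × β => h x.1 x.2) : Poly fun a => (f a).map fun b => h a b := by
  have h := hf.flatMap (h := fun a b => [h a b]) (by fun_prop)
  convert h using 2 with a
  exact List.map_eq_flatMap

@[fun_prop] theorem Poly.filter {f : α → List β} {h : α → β → Bool} (hf : Poly f)
    (hh : Poly fun x : α × β => h x.1 x.2) : Poly fun a => (f a).filter fun b => h a b := by
  have h := hf.flatMap (h := fun a b => if h a b then [b] else []) (by fun_prop)
  convert h using 2 with a
  induction f a with
  | nil => rfl
  | cons b l ih => rw [List.filter_cons, List.flatMap_cons, ih]; split_ifs <;> rfl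

@[fun_prop] theorem Poly.flatten {f : α → List (List β)} (hf : Poly f) :
    Poly fun a => (f a).flatten := by
  have h := hf.flatMap (h := fun _ b => b) (by fun_prop)
  convert h using 2 with a
  simp [List.flatMap_id']

@[fun_prop] theorem Poly.all {f : α → List β} {h : α → β → Bool} (hf : Poly f)
    (hh : Poly fun x : α × β => h x.1 x.2) : Poly fun a => (f a).all fun b => h a b := by
  have h := (hf.filter (h := fun a b => !h a b) (by fun_prop)).isEmpty
  convert h using 2 with a
  rw [Bool.eq_iff_iff]
  simp

@[fun_prop] theorem Poly.any {f : α → List β} {h : α → β → Bool} (hf : Poly f)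
    (hh : Poly fun x : α × β => h x.1 x.2) : Poly fun a => (f a).any fun b => h a b := by
  have h := (hf.all (h := fun a b => !h a b) (by fun_prop)).not
  convert h using 2 with a
  rw [Bool.eq_iff_iff]
  simp

@[fun_prop] theorem Poly.takeWhile {f : α → List β} {h : α → β → Bool} (hf : Poly f)
    (hh : Poly fun x : α × β => h x.1 x.2) : Poly fun a => (f a).takeWhile fun b => h a b := by
  have h := hf.foldr (g := fun _ => []) (h := fun a b l => if h a b then b :: l else []) (.const _)
    (.ite (hh.comp (f := fun x : α × β × List β => (x.1, x.2.1)) (by fun_prop)) (by fun_prop)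
      (.const _)) (D := fun a => size (f a) + 1) (hf.1.add (.const 1)) fun a x b hb => by
      have := size_le_of_mem hb
      split_ifs <;> simp <;> omega
  convert h using 2 with a
  induction f a with
  | nil => rfl
  | cons b l ih => rw [List.takeWhile_cons, List.foldr_cons, ih]

-- The result is built in reverse by a left fold. An empty accumulator indicates that dropping is
-- still going on; the first element kept ends this for good.
@[fun_prop] theorem Poly.dropWhile {f : α → List β} {h : α → β → Bool} (hf : Poly f)
    (hh : Poly fun x : α × β => h x.1 x.2) : Poly fun a => (f a).dropWhile fun b => h a b := by
  have h1 := (hf.foldl (g := fun _ => [])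
    (h := fun a l b => if l.isEmpty && h a b then [] else b :: l) (.const _)
    (.ite (.and (by fun_prop) (hh.comp (f := fun x : α × List β × β => (x.1, x.2.2))
      (by fun_prop))) (by fun_prop) (by fun_prop))
    (D := fun a => size (f a) + 1) (hf.1.add (.const 1)) fun a x b hb => by
      have := size_le_of_mem hb
      split_ifs <;> simp <;> omega).reverse
  convert h1 using 2 with a
  have key (l : List β) (x : List β) (hx : x ≠ []) :
      l.foldl (fun l b => if l.isEmpty && h a b then [] else b :: l) x = l.reverse ++ x := by
    induction l generalizing x with
    | nil => rfl
    | cons b l ih =>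
      rw [List.foldl_cons, ih] <;> simp [hx]
  induction f a with
  | nil => rfl
  | cons b l ih =>
    by_cases hb : h a b
    · simp [hb, ih]
    · rw [List.foldl_cons, if_neg (by simp [hb]), key _ _ (by simp)]
      simp [hb]

@[fun_prop] theorem Poly.dropLast {f : α → List β} (hf : Poly f) :
    Poly fun a => (f a).dropLast := by
  have h : Poly fun a => (f a).reverse.tail.reverse := by fun_prop
  simpa using h

end

/-! ### Splittings of a list into a prefix and a suffix. -/

section Splits

variable {β : Type}

/-- All suffixes of a list, each with the prefix before it. -/
def splits (l : List β) : List (List β × List β) :=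
  l.foldr (fun b s => ([], b :: (s.headD ([], [])).2) :: s.map fun x => (b :: x.1, x.2)) [([], [])]

theorem headD_splits (l : List β) : (splits l).headD ([], []) = ([], l) := by
  induction l with
  | nil => rfl
  | cons b l ih =>
    have h : splits (b :: l) = ([], b :: ((splits l).headD ([], [])).2) ::
      (splits l).map fun x => (b :: x.1, x.2) := rfl
    rw [h, ih]
    rfl

theorem splits_cons (b : β) (l : List β) :
    splits (b :: l) = ([], b :: l) :: (splits l).map fun x => (b :: x.1, x.2) := by
  have h : splits (b :: l) = ([], b :: ((splits l).headD ([], [])).2) ::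
    (splits l).map fun x => (b :: x.1, x.2) := rfl
  rw [h, headD_splits]

theorem mem_splits (l : List β) (x : List β × List β) : x ∈ splits l ↔ x.1 ++ x.2 = l := by
  induction l generalizing x with
  | nil => simp [splits, Prod.ext_iff]
  | cons b l ih =>
    rcases x with ⟨y, z⟩
    rw [splits_cons]
    cases y with
    | nil => simp
    | cons c y =>
      simp only [List.mem_cons, Prod.mk.injEq, reduceCtorEq, false_and, List.mem_map, Prod.exists,
        List.cons.injEq, false_or, List.cons_append, ih]
      constructor
      · rintro ⟨y', z', h, ⟨rfl, rfl⟩, rfl⟩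
        exact ⟨rfl, h⟩
      · rintro ⟨rfl, h⟩
        exact ⟨y, z, h, ⟨rfl, rfl⟩, rfl⟩

theorem length_splits (l : List β) : (splits l).length = l.length + 1 := by
  induction l with
  | nil => rfl
  | cons b l ih => simp [splits_cons, ih]

end Splits

section

variable {α β : Type} [Enc α] [Enc β]

theorem size_le_of_forall_mem {l : List α} {c : ℕ} (h : ∀ a ∈ l, size a ≤ c) :
    size l ≤ l.length * (c + 1) + 1 := by
  induction l with
  | nil => simp
  | cons a l ih =>
    have h1 := ih fun b hb => h b (List.mem_cons_of_mem _ hb)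
    have h2 := h a List.mem_cons_self
    simp only [size_cons, List.length_cons, add_mul]
    omega

theorem size_splits_le (l : List β) : size (splits l) ≤ (size l + 1) * (size l + 3) + 1 := by
  have h := size_le_of_forall_mem (l := splits l) (c := size l + 2) fun x hx => by
    have := size_append x.1 x.2
    rw [(mem_splits l x).1 hx] at this
    rcases x with ⟨y, z⟩
    simp only [size_pair] at *
    omega
  rw [length_splits] at h
  exact h.trans (Nat.add_le_add_right (Nat.mul_le_mul_right _
    (Nat.add_le_add_right (length_le_size l) 1)) 1)

theorem size_le_of_suffix {l l' : List β} (h : l <:+ l') : size l ≤ size l' := by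
  obtain ⟨t, rfl⟩ := h
  have := size_append t l
  have := one_le_size t
  omega

-- A step lengthens every pair found so far, so its growth depends on the state. The bound comes
-- instead from the fact that each intermediate state is `splits` of a suffix, which has quadratic
-- size.
@[fun_prop] theorem Poly.splits {f : α → List β} (hf : Poly f) :
    Poly fun a => splits (f a) := by
  have h := hf.reverse.foldl_of_bound (g := fun _ => [([], [])])
    (h := fun _ s b => ([], b :: (s.headD ([], [])).2) :: s.map fun x => (b :: x.1, x.2))
    (.const _) (by fun_prop) (D := fun a => (size (f a) + 1) * (size (f a) + 3) + 1)
    (((hf.1.add (.const 1)).mul (hf.1.add (.const 3))).add (.const 1)) fun a l hl => by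
      have h1 : l.reverse <:+ f a := by simpa using List.reverse_suffix.2 hl
      have h2 := size_le_of_suffix h1
      have h3 := size_splits_le l.reverse
      rw [PolyTime.splits, List.foldr_reverse] at h3
      exact h3.trans (by gcongr)
  convert h using 2 with a
  rw [List.foldl_reverse, PolyTime.splits]

end

end PolyTime

namespace PolyTime

section

variable {α β γ : Type} [Enc α] [Enc β] [Enc γ]

/-! #### Equality tests -/

/-- Equality as a truth value. -/
def eqb [DecidableEq β] (a b : β) : Bool := decide (a = b)

omit [Enc β] in
@[simp] theorem eqb_iff [DecidableEq β] (a b : β) : eqb a b = true ↔ a = b := by simp [eqb]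

/-- Types with an equality test computable in polynomial time. -/
class PolyEq (β : Type) [Enc β] [DecidableEq β] : Prop where
  poly : Poly fun p : β × β => eqb p.1 p.2

@[fun_prop] theorem Poly.eqb [DecidableEq β] [PolyEq β] {f g : α → β} (hf : Poly f)
    (hg : Poly g) : Poly fun a => eqb (f a) (g a) :=
  PolyEq.poly.comp (hf.pair hg)

instance : PolyEq Bool where
  poly := by
    have h : Poly fun p : Bool × Bool => if p.1 then p.2 else !p.2 := by fun_prop
    convert h using 2 with p
    rcases p with ⟨_ | _, _ | _⟩ <;> rfl

/-- The second list is consumed alongside the first, with a flag for agreement so far; at the end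
nothing may be left over. The default `b` of `headD` would count as agreement, hence the separate
test for emptiness. -/
instance [DecidableEq β] [PolyEq β] : PolyEq (List β) where
  poly := by
    have h := Poly.foldl (f := fun p : List β × List β => p.1) (g := fun p => (p.2, true))
      (h := fun _ x b => (x.1.tail, x.2 && !x.1.isEmpty && PolyTime.eqb (x.1.headD b) b))
      (by fun_prop) (by fun_prop) (by fun_prop) (D := fun _ => 3) (.const _)
      fun a x b _ => by
        rcases x with ⟨l, c⟩
        have h1 := size_bool_le (c && !l.isEmpty && PolyTime.eqb (l.headD b) b)
        have h2 : size l.tail ≤ size l := size_le_of_suffix (List.tail_suffix l)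
        simp only [size_pair]
        omega
    have h' : Poly fun p : List β × List β => (p.1.foldl (fun x b => (x.1.tail,
        x.2 && !x.1.isEmpty && PolyTime.eqb (x.1.headD b) b)) (p.2, true)).2 &&
        (p.1.foldl (fun x b => (x.1.tail,
        x.2 && !x.1.isEmpty && PolyTime.eqb (x.1.headD b) b)) (p.2, true)).1.isEmpty := by
      fun_prop
    convert h' using 2 with p
    have key (l l' : List β) (c : Bool) :
        ((l.foldl (fun x b => (x.1.tail, x.2 && !x.1.isEmpty && PolyTime.eqb (x.1.headD b) b))
          (l', c)).2 && (l.foldl (fun x b => (x.1.tail,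
          x.2 && !x.1.isEmpty && PolyTime.eqb (x.1.headD b) b)) (l', c)).1.isEmpty) =
          (c && decide (l = l')) := by
      induction l generalizing l' c with
      | nil => cases l' <;> simp
      | cons b l ih =>
        rw [List.foldl_cons, ih]
        cases l' with
        | nil => simp
        | cons b' l' =>
          rw [Bool.eq_iff_iff]
          simp only [List.tail_cons, List.isEmpty_cons, List.headD_cons, List.cons.injEq,
            PolyTime.eqb, Bool.not_false, Bool.and_true, eq_comm (a := b'), and_assoc,
            Bool.and_eq_true, decide_eq_true_iff]
          exact and_congr_right fun _ => and_congr_right fun _ => decide_eq_true_iff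
    rw [key]
    rfl

theorem PolyEq.of_injective [DecidableEq β] [DecidableEq γ] [PolyEq γ] (e : β → γ)
    (he : Function.Injective e) (h : ∀ b, Enc.tree (e b) = Enc.tree b) : PolyEq β where
  poly := by
    have he' : Poly e := Poly.id.of_tree_eq h
    have h' : Poly fun p : β × β => PolyTime.eqb (e p.1) (e p.2) := by fun_prop
    convert h' using 2 with p
    simp [PolyTime.eqb, he.eq_iff]

/-! #### Natural numbers -/

/-- Numbers are represented by their binary digits, so polynomial bounds refer to bit length, as
binary weights require. -/
instance : Enc ℕ where
  tree n := Enc.tree (Computability.encodeNat n)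

theorem encodeNat_zero : Computability.encodeNat 0 = [] := rfl

/-- Digits are listed from the least significant one; the hypothesis excludes a leading zero. -/
theorem encodeNat_bit (b : Bool) (n : ℕ) (h : n = 0 → b = true) :
    Computability.encodeNat (Nat.bit b n) = b :: Computability.encodeNat n := by
  change Computability.encodeNum (Num.ofNat' _) = b :: Computability.encodeNum (Num.ofNat' n)
  rw [Num.ofNat'_bit]
  rcases hn : Num.ofNat' n with _ | m
  · have : n = 0 := by
      have h1 := Num.to_of_nat n
      change ((Num.ofNat' n : Num) : ℕ) = n at h1
      rw [hn] at h1
      exact h1.symm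
    rw [h this]
    rfl
  · cases b <;> rfl

/-- The number with the given binary digits, least significant digit first. -/
def ofBits (l : List Bool) : ℕ := l.foldr (fun b n => Nat.bit b n) 0

@[simp] theorem ofBits_nil : ofBits [] = 0 := rfl

@[simp] theorem ofBits_cons (b : Bool) (l : List Bool) :
    ofBits (b :: l) = Nat.bit b (ofBits l) := rfl

@[simp] theorem ofBits_encodeNat (n : ℕ) : ofBits (Computability.encodeNat n) = n := by
  induction n using Nat.binaryRec' with
  | zero => rfl
  | bit b n h ih => rw [encodeNat_bit b n h, ofBits_cons, ih]

/-- Leading zeros stand at the end of the list: working from there, a zero is kept only if some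
digit has been kept already. This normalization is what makes `ofBits` computable on codes. -/
theorem encodeNat_ofBits (l : List Bool) : Computability.encodeNat (ofBits l) =
    l.foldr (fun b m => if b || !m.isEmpty then b :: m else []) [] := by
  induction l with
  | nil => rfl
  | cons b l ih =>
    rw [List.foldr_cons, ← ih, ofBits_cons]
    by_cases h : ofBits l = 0 → b = true
    · rw [encodeNat_bit b _ h, if_pos]
      by_cases h0 : ofBits l = 0
      · simp [h h0]
      · have : Computability.encodeNat (ofBits l) ≠ [] := fun h1 => h0 (by
          rw [← ofBits_encodeNat (ofBits l), h1]; rfl)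
        simp [this]
    · push Not at h
      obtain ⟨h0, hb⟩ := h
      rw [h0]
      cases b
      · rfl
      · exact absurd rfl hb

theorem encodeNat_injective : Function.Injective Computability.encodeNat :=
  Function.LeftInverse.injective ofBits_encodeNat

instance : PolyEq ℕ := .of_injective Computability.encodeNat encodeNat_injective fun _ => rfl

@[fun_prop] theorem Poly.encodeNat {f : α → ℕ} (hf : Poly f) :
    Poly fun a => Computability.encodeNat (f a) := hf.of_tree_eq fun _ => rfl

@[fun_prop] theorem Poly.ofBits {f : α → List Bool} (hf : Poly f) : Poly fun a => ofBits (f a) := by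
  have h := hf.foldr (g := fun _ => ([] : List Bool))
    (h := fun _ b m => if b || !m.isEmpty then b :: m else []) (.const _) (by fun_prop)
    (D := fun _ => 4) (.const _) fun a x b _ => by
      have := size_bool_le b
      split_ifs <;> simp; omega
  refine h.of_tree_eq fun a => ?_
  rw [← encodeNat_ofBits]
  rfl

theorem size_nat_le (n : ℕ) : size n ≤ (Computability.encodeNat n).length * 4 + 1 :=
  size_le_of_forall_mem (l := Computability.encodeNat n) fun b _ => size_bool_le b

theorem length_encodeNat_le {n k : ℕ} (h : n < 2 ^ k) :
    (Computability.encodeNat n).length ≤ k := by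
  induction n using Nat.binaryRec' generalizing k with
  | zero => simp [encodeNat_zero]
  | bit b n hn ih =>
    rw [encodeNat_bit b n hn]
    cases k with
    | zero =>
      rw [Nat.bit_val] at h
      have h0 : n = 0 := by omega
      simp [hn h0] at h
    | succ k =>
      have := ih (k := k) (by rw [Nat.bit_val, pow_succ] at h; omega)
      simpa using this

theorem ofBits_lt (l : List Bool) : ofBits l < 2 ^ l.length := by
  induction l with
  | nil => simp
  | cons b l ih =>
    rw [ofBits_cons, Nat.bit_val, List.length_cons, pow_succ]
    have := Bool.toNat_le b
    omega

theorem lt_two_pow_length_encodeNat (n : ℕ) : n < 2 ^ (Computability.encodeNat n).length := by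
  simpa using ofBits_lt (Computability.encodeNat n)

theorem add_lt_two_pow {m n i j : ℕ} (hm : m < 2 ^ i) (hn : n < 2 ^ j) :
    m + n < 2 ^ (i + j + 1) := by
  have h1 : 2 ^ i ≤ 2 ^ i * 2 ^ j := Nat.le_mul_of_pos_right _ (by positivity)
  have h2 : 2 ^ j ≤ 2 ^ i * 2 ^ j := Nat.le_mul_of_pos_left _ (by positivity)
  rw [pow_succ, pow_add]
  omega

/-- One step of the addition of two numbers, given by their remaining digits, with a carry. -/
def addStep (x : (List Bool × List Bool) × Bool × List Bool) :
    (List Bool × List Bool) × Bool × List Bool :=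
  ((x.1.1.tail, x.1.2.tail),
    if x.1.1.headD false then x.1.2.headD false || x.2.1 else x.1.2.headD false && x.2.1,
    eqb (x.1.1.headD false) (eqb (x.1.2.headD false) x.2.1) :: x.2.2)

theorem ofBits_eq_tail (l : List Bool) :
    ofBits l = 2 * ofBits l.tail + (l.headD false).toNat := by
  cases l with
  | nil => simp
  | cons b l => simp [Nat.bit_val]

/-- Addition with carry. The list `k` is only a clock; the bound on the sum ensures that it runs
long enough for all digits and the last carry to be used up. -/
theorem foldl_addStep (k : List Bool) (x y : List Bool) (c : Bool) (z : List Bool)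
    (h : ofBits x + ofBits y + c.toNat < 2 ^ k.length) :
    ∃ o, (k.foldl (fun s _ => addStep s) ((x, y), c, z)).2.2 = o.reverse ++ z ∧
      ofBits o = ofBits x + ofBits y + c.toNat := by
  induction k generalizing x y c z with
  | nil =>
    simp only [List.length_nil, pow_zero] at h
    exact ⟨[], rfl, by simp; omega⟩
  | cons b k ih =>
    rw [List.length_cons, pow_succ] at h
    have hx := ofBits_eq_tail x
    have hy := ofBits_eq_tail y
    rw [List.foldl_cons, show addStep ((x, y), c, z) = ((x.tail, y.tail),
      if x.headD false then y.headD false || c else y.headD false && c,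
      eqb (x.headD false) (eqb (y.headD false) c) :: z) from rfl]
    generalize x.headD false = u at *
    generalize y.headD false = v at *
    obtain ⟨o, h1, h2⟩ := ih x.tail y.tail (if u then v || c else v && c) (eqb u (eqb v c) :: z)
      (by cases u <;> cases v <;> cases c <;> simp at * <;> omega)
    refine ⟨eqb u (eqb v c) :: o, by rw [h1]; simp, ?_⟩
    rw [ofBits_cons, h2, Nat.bit_val]
    cases u <;> cases v <;> cases c <;> simp [eqb] at * <;> omega

@[fun_prop] theorem Poly.add {f g : α → ℕ} (hf : Poly f) (hg : Poly g) :
    Poly fun a => f a + g a := by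
  have h := Poly.foldl (σ := (List Bool × List Bool) × Bool × List Bool)
    -- A clock of `i + j + 1` ticks for summands of `i` and `j` digits, as justified by
    -- `add_lt_two_pow`.
    (f := fun a => true :: (Computability.encodeNat (f a) ++ Computability.encodeNat (g a)))
    (g := fun a => ((Computability.encodeNat (f a), Computability.encodeNat (g a)), false, []))
    (h := fun _ s _ => addStep s) (by fun_prop) (by fun_prop) (by unfold addStep; fun_prop)
    (D := fun _ => 7) (.const _) fun a x b _ => by
      rcases x with ⟨⟨x, y⟩, c, z⟩
      have h1 : size x.tail ≤ size x := size_le_of_suffix (List.tail_suffix x)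
      have h2 : size y.tail ≤ size y := size_le_of_suffix (List.tail_suffix y)
      have h3 := size_bool_le (if x.headD false then y.headD false || c else y.headD false && c)
      have h4 := size_bool_le (PolyTime.eqb (x.headD false) (PolyTime.eqb (y.headD false) c))
      simp only [size_pair, addStep, size_cons]
      omega
  have h' := (h.snd'.snd'.reverse).ofBits
  convert h' using 2 with a
  obtain ⟨o, h1, h2⟩ := foldl_addStep
    (true :: (Computability.encodeNat (f a) ++ Computability.encodeNat (g a)))
    (Computability.encodeNat (f a)) (Computability.encodeNat (g a)) false [] (by
      simpa using add_lt_two_pow (lt_two_pow_length_encodeNat (f a))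
        (lt_two_pow_length_encodeNat (g a)))
  rw [h1]
  simp [h2]

/-- The order of natural numbers as a truth value. -/
def ltb (m n : ℕ) : Bool := decide (m < n)

@[simp] theorem ltb_iff (m n : ℕ) : ltb m n = true ↔ m < n := by simp [ltb]

/-- One step of the comparison of two numbers, given by their remaining digits. -/
def ltStep (x : (List Bool × List Bool) × Bool) : (List Bool × List Bool) × Bool :=
  ((x.1.1.tail, x.1.2.tail),
    if eqb (x.1.1.headD false) (x.1.2.headD false) then x.2 else x.1.2.headD false)

/-- The least significant digits come first, so a later difference overrides an earlier verdict, and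
equal digits preserve it. -/
theorem foldl_ltStep (k : List Bool) (x y : List Bool) (c : Bool) (hx : ofBits x < 2 ^ k.length)
    (hy : ofBits y < 2 ^ k.length) :
    (k.foldl (fun s _ => ltStep s) ((x, y), c)).2 = true ↔
      ofBits x < ofBits y ∨ ofBits x = ofBits y ∧ c = true := by
  induction k generalizing x y c with
  | nil =>
    simp only [List.length_nil, pow_zero, Nat.lt_one_iff] at hx hy
    simp [hx, hy]
  | cons b k ih =>
    rw [List.length_cons, pow_succ] at hx hy
    have hx' := ofBits_eq_tail x
    have hy' := ofBits_eq_tail y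
    rw [List.foldl_cons, ltStep, ih _ _ _ (by simp only; omega) (by simp only; omega)]
    simp only
    generalize x.headD false = u at *
    generalize y.headD false = v at *
    cases u <;> cases v <;> cases c <;> simp [eqb] at * <;> omega

@[fun_prop] theorem Poly.ltb {f g : α → ℕ} (hf : Poly f) (hg : Poly g) :
    Poly fun a => ltb (f a) (g a) := by
  have h := Poly.foldl (σ := (List Bool × List Bool) × Bool)
    (f := fun a => Computability.encodeNat (f a) ++ Computability.encodeNat (g a))
    (g := fun a => ((Computability.encodeNat (f a), Computability.encodeNat (g a)), false))
    (h := fun _ s _ => ltStep s) (by fun_prop) (by fun_prop) (by unfold ltStep; fun_prop)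
    (D := fun _ => 3) (.const _) fun a x b _ => by
      rcases x with ⟨⟨x, y⟩, c⟩
      have h1 : size x.tail ≤ size x := size_le_of_suffix (List.tail_suffix x)
      have h2 : size y.tail ≤ size y := size_le_of_suffix (List.tail_suffix y)
      have h3 := size_bool_le
        (if PolyTime.eqb (x.headD false) (y.headD false) then c else y.headD false)
      simp only [size_pair, ltStep]
      omega
  convert h.snd' using 2 with a
  have h1 := lt_two_pow_length_encodeNat (f a)
  have h2 := lt_two_pow_length_encodeNat (g a)
  rw [Bool.eq_iff_iff, foldl_ltStep]
  · simp
  · rw [ofBits_encodeNat, List.length_append, pow_add]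
    exact h1.trans_le (Nat.le_mul_of_pos_right _ (by positivity))
  · rw [ofBits_encodeNat, List.length_append, pow_add]
    exact h2.trans_le (Nat.le_mul_of_pos_left _ (by positivity))

theorem length_encodeNat_sum_le (l : List ℕ) :
    (Computability.encodeNat l.sum).length ≤ size l := by
  induction l with
  | nil => simp [encodeNat_zero]
  | cons n l ih =>
    have h1 := lt_two_pow_length_encodeNat n
    have h2 := lt_two_pow_length_encodeNat l.sum
    have h3 : (Computability.encodeNat n).length ≤ size n :=
      length_le_size (Computability.encodeNat n)
    refine (length_encodeNat_le (k := (Computability.encodeNat n).length +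
      (Computability.encodeNat l.sum).length + 1) ?_).trans (by simp; omega)
    rw [List.sum_cons]
    exact add_lt_two_pow h1 h2

@[fun_prop] theorem Poly.sum {f : α → List ℕ} (hf : Poly f) : Poly fun a => (f a).sum := by
  have h := hf.reverse.foldl_of_bound (g := fun _ => 0) (h := fun _ m n => n + m) (.const _)
    (by fun_prop) (D := fun a => size (f a) * 4 + 1) ((hf.1.mul (.const 4)).add (.const 1))
    fun a l hl => by
      have h1 : l.reverse <:+ f a := by simpa using List.reverse_suffix.2 hl
      have h2 := size_le_of_suffix h1
      have h3 := length_encodeNat_sum_le l.reverse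
      have h4 := size_nat_le l.reverse.sum
      rw [List.sum, List.foldr_reverse] at h3 h4
      exact h4.trans (by omega)
  convert h using 2 with a
  rw [List.foldl_reverse]
  rfl

end

end PolyTime

namespace PolyTime

open Prog

/-! #### Words over the input alphabet -/

/-- A code of fixed length for the symbols; the first bit marks binary digits. -/
def symbolBits : TiedVoting.Symbol → List Bool
  | .blank => [false, false, false]
  | .bit b => [true, b, false]
  | .bra => [false, false, true]
  | .ket => [false, true, false]
  | .comma => [false, true, true]

theorem symbolBits_injective : Function.Injective symbolBits := by
  intro x y h
  revert x y
  decide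

instance : Enc TiedVoting.Symbol where
  tree x := Enc.tree (symbolBits x)

instance : PolyEq TiedVoting.Symbol := .of_injective symbolBits symbolBits_injective fun _ => rfl

section

variable {α β γ : Type} [Enc α] [Enc β] [Enc γ]

@[fun_prop] theorem Poly.symbolBits {f : α → TiedVoting.Symbol} (hf : Poly f) :
    Poly fun a => symbolBits (f a) := hf.of_tree_eq fun _ => rfl

/-- The bit carried by a symbol. -/
def digit (x : TiedVoting.Symbol) : Bool := (symbolBits x).tail.headD false

/-- Does the symbol carry a bit? -/
def isDigit (x : TiedVoting.Symbol) : Bool := (symbolBits x).headD false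

@[fun_prop] theorem Poly.digit {f : α → TiedVoting.Symbol} (hf : Poly f) :
    Poly fun a => digit (f a) := by
  unfold PolyTime.digit
  fun_prop

@[fun_prop] theorem Poly.isDigit {f : α → TiedVoting.Symbol} (hf : Poly f) :
    Poly fun a => isDigit (f a) := by
  unfold PolyTime.isDigit
  fun_prop

@[fun_prop] theorem Poly.bit {f : α → Bool} (hf : Poly f) :
    Poly fun a => (.bit (f a) : TiedVoting.Symbol) :=
  Poly.of_tree_eq (f := fun a => [true, f a, false]) (by fun_prop) fun _ => rfl

/-- A digit symbol in a word takes at least eight cells, counting the list node, while a digit of a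
number takes at most four. This slack guarantees that parsing does not increase sizes. -/
theorem seven_le_size (x : TiedVoting.Symbol) : 7 ≤ size x := by
  rcases x with _ | ⟨_ | _⟩ | _ | _ | _ <;> decide

theorem size_symbol_le (x : TiedVoting.Symbol) : size x ≤ 13 := by
  rcases x with _ | ⟨_ | _⟩ | _ | _ | _ <;> decide

/-- Push a word onto `aux`, first symbol first. -/
def pushAux : List Bool → Prog Alph
  | [] => skip
  | b :: w => seq (push .aux b) (pushAux w)

theorem run_pushAux (w : List Bool) {m s a c i o} :
    RunLE (pushAux w) (st m s a c i o) (st m s (w.reverse ++ a) c i o) (w.length + 1) := by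
  induction w generalizing a with
  | nil => exact runLE_skip _
  | cons b w ih =>
    have h := (run_push_aux b).seq (ih (a := b :: a))
    rw [List.reverse_cons, List.append_assoc]
    exact RunLE.mono h (by simp; omega)

/-- Read the input and write its code to `main`. -/
def load : Prog Alph :=
  seq (push .main false)
    (seq (loop .inp fun x : TiedVoting.Symbol => pushAux (true :: code x)) (unload true false))

/-- The code of a word consists of the blocks `true :: code x` and a final `false`. That `false` is
placed on `main` in advance, so the loop has to produce everything but the last symbol. -/
theorem run_loadLoop (w : List TiedVoting.Symbol) {m s a c o} :
    ∃ a', a'.reverse = a.reverse ++ (code w).dropLast ∧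
      RunLE (loop .inp fun x : TiedVoting.Symbol => pushAux (true :: code x))
        (st m s a c w o) (st m s a' c [] o) (3 * size w) := by
  induction w generalizing a with
  | nil => exact ⟨a, by simp [code_nil], (runLE_loop_nil _ rfl).mono (by simp)⟩
  | cons x w ih =>
    obtain ⟨a', h1, h2⟩ := ih (a := (true :: code x).reverse ++ a)
    refine ⟨a', ?_, (run_loop_inp (run_pushAux (true :: code x)) h2).mono ?_⟩
    · rw [h1, code_cons]
      have : code w ≠ [] := by
        intro h
        have := one_le_size w
        rw [size, h] at this
        simp at this
      rw [List.dropLast_cons_of_ne_nil (by simp [this]), List.dropLast_append_of_ne_nil this]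
      simp
    · have := seven_le_size x
      simp only [List.length_cons, size_cons]
      simp only [size] at *
      omega

theorem getLast_code_list (l : List β) : (code l).dropLast ++ [false] = code l := by
  induction l with
  | nil => rfl
  | cons b l ih =>
    have : code l ≠ [] := by
      intro h
      rw [h] at ih
      simp at ih
    rw [code_cons, List.dropLast_cons_of_ne_nil (by simp [this]),
      List.dropLast_append_of_ne_nil this, List.cons_append, List.append_assoc, ih]

theorem run_load (w : List TiedVoting.Symbol) :
    RunLE load (st [] [] [] [] w []) (conf (code w) []) (6 * size w + 2) := by
  obtain ⟨a, h1, h2⟩ := run_loadLoop w (m := [false]) (s := []) (a := []) (c := []) (o := [])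
  have h3 := run_unload true false a (m := [false]) (s := []) (c := []) (i := []) (o := [])
  rw [h1] at h3
  simp only [List.reverse_nil, List.nil_append, if_true, Bool.false_eq_true, if_false,
    getLast_code_list] at h3
  refine ((run_push_main false).seq (h2.seq h3)).mono ?_
  have := congrArg List.length h1
  simp [size] at *
  omega

/-- Write the truth value on `main` to the output. -/
def store_output : Prog Alph := cond .main fun b =>
  if b = some true then seq (cond .main fun _ => cond .main fun _ => skip) (push .out true)
  else push .out false

theorem run_store_output (b : Bool) :
    RunLE store_output (conf (code b) []) (st [] [] [] [] [] [b]) 5 := by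
  cases b
  · exact RunLE.mono (run_cond_main (b := false) (run_push_out false)) (by omega)
  · exact RunLE.mono (run_cond_main (b := true) (RunLE.seq (run_cond_main (b := false)
      (P := fun _ => cond .main fun _ => skip) (run_cond_main (b := false) (P := fun _ => skip)
        (runLE_skip _))) (run_push_out true))) (by omega)

theorem st_inp (w : List TiedVoting.Symbol) :
    st [] [] [] [] w [] = Function.update (β := fun k => List (Alph k)) (fun _ => []) Reg.inp w := by
  funext k; cases k <;> rfl

theorem st_out (o : List Bool) :
    st [] [] [] [] [] o = Function.update (β := fun k => List (Alph k)) (fun _ => []) Reg.out o := by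
  funext k; cases k <;> rfl

/-- A symbol takes at most fourteen cells including its list node, so bounds in `size w` become
bounds in the length of `w`. -/
theorem Poly.inP {A : Set (List TiedVoting.Symbol)} {f : List TiedVoting.Symbol → Bool}
    (hf : Poly f) (h : ∀ w, f w = true ↔ w ∈ A) : TiedVoting.InP A := by
  obtain ⟨-, p, t, ⟨T, hT⟩, hp⟩ := hf
  classical
  have hsize (w : List TiedVoting.Symbol) : size w ≤ 14 * w.length + 1 := by
    have := size_le_of_forall_mem (l := w) fun x _ => size_symbol_le x
    omega
  have key (w : List TiedVoting.Symbol) : RunLE (seq load (seq p store_output))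
      (Function.update (fun _ => []) Reg.inp w) (Function.update (fun _ => []) Reg.out [f w])
      (6 * size w + 2 + (t w + 5)) := by
    rw [← st_inp, ← st_out]
    refine (run_load w).seq (RunLE.seq ?_ (run_store_output (f w)))
    simpa using hp w [] []
  refine ⟨{
    tm := machine (seq load (seq p store_output)) .inp .out
    inputAlphabet := Equiv.refl _
    outputAlphabet := Equiv.refl _
    time := 84 * Polynomial.X + T.comp (14 * Polynomial.X + 1) + 14
    outputsFun := fun w => ?_ }⟩
  refine Classical.choice ?_
  obtain ⟨H⟩ := ((key w).mono (t' := 84 * w.length + T.eval (14 * w.length + 1) + 13) (by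
    have h1 := hsize w
    have h2 := (hT w).trans (eval_monotone T h1)
    simp only at h2
    omega)).outputsInTime
  have hw : f w = decide (w ∈ A) := by
    rw [Bool.eq_iff_iff, h]
    simp
  have e1 : List.map (Equiv.refl TiedVoting.Symbol).invFun w = w := List.map_id _
  have e2 : List.map (Equiv.refl Bool).invFun (Computability.encodeBool (decide (w ∈ A))) =
      [f w] := by rw [hw]; rfl
  have e3 : (84 * Polynomial.X + T.comp (14 * Polynomial.X + 1) + 14 : Polynomial ℕ).eval w.length =
      84 * w.length + T.eval (14 * w.length + 1) + 13 + 1 := by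
    simp [Polynomial.eval_comp]
  -- The types of the words depend on the machine; for a variable `M` the equations can be
  -- substituted.
  have transfer : ∀ (M : Turing.FinTM2) {x x' : List (M.Γ M.k₀)}
      {o o' : Option (List (M.Γ M.k₁))} {n n' : ℕ}, x = x' → o = o' → n = n' →
      Turing.TM2OutputsInTime M x o n → Nonempty (Turing.TM2OutputsInTime M x' o' n') := by
    rintro _ _ _ _ _ _ _ rfl rfl rfl H
    exact ⟨H⟩
  exact transfer _ e1.symm (congrArg some e2.symm) e3.symm H

end

end PolyTime

namespace PolyTime

open TiedVoting

section

variable {α β γ : Type} [Enc α] [Enc β] [Enc γ]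

/-! #### Parsing

A parser splits off a value from the front of a word. -/

/-- Parse a number. -/
def parseNumber (w : List Symbol) : ℕ × List Symbol :=
  (ofBits ((w.takeWhile fun x => isDigit x).map fun x => digit x),
    (w.dropWhile fun x => isDigit x).tail)

theorem poly_parseNumber : Poly parseNumber := by
  unfold parseNumber
  fun_prop

theorem parseNumber_encode (n : ℕ) (r : List Symbol) :
    parseNumber (encodeNumber n ++ r) = (n, r) := by
  have hb (b : Bool) : isDigit (.bit b) = true := rfl
  have h1 (l : List Bool) : ((l.map Computability.Γ'.bit ++ [Computability.Γ'.comma]) ++ r).takeWhile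
      (fun x => isDigit x) = l.map Computability.Γ'.bit := by
    induction l with
    | nil => rfl
    | cons b l ih =>
      simp only [List.map_cons, List.cons_append, List.takeWhile_cons, hb, if_true]
      exact congrArg _ ih
  have h2 (l : List Bool) : ((l.map Computability.Γ'.bit ++ [Computability.Γ'.comma]) ++ r).dropWhile
      (fun x => isDigit x) = Computability.Γ'.comma :: r := by
    induction l with
    | nil => rfl
    | cons b l ih =>
      simp only [List.map_cons, List.cons_append, List.dropWhile_cons, hb, if_true]
      exact ih
  rw [parseNumber, encodeNumber, h1, h2, List.map_map]
  have h3 : (fun x => digit x) ∘ Computability.Γ'.bit = id := by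
    funext b
    rfl
  rw [h3, List.map_id, ofBits_encodeNat]
  rfl

/-- `p` consumes at least `c` more than the size of its value on nonempty words. -/
def Shrinks (c : ℕ) (p : List Symbol → β × List Symbol) : Prop :=
  ∀ w, w ≠ [] → size (p w).1 + size (p w).2 + c ≤ size w

theorem Shrinks.mono {c c' : ℕ} {p : List Symbol → β × List Symbol} (h : Shrinks c p)
    (hc : c' ≤ c) : Shrinks c' p := fun w hw => by
  have := h w hw
  omega

theorem size_ofBits_le (l : List Bool) : size (ofBits l) ≤ l.length * 4 + 1 := by
  have := size_nat_le (ofBits l)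
  have := length_encodeNat_le (ofBits_lt l)
  omega

theorem shrinks_parseNumber : Shrinks 3 parseNumber := by
  intro w hw
  rw [parseNumber]
  have h1 := size_ofBits_le ((w.takeWhile fun x => isDigit x).map fun x => digit x)
  have h2 : (w.takeWhile fun x => isDigit x) ++ (w.dropWhile fun x => isDigit x) = w :=
    List.takeWhile_append_dropWhile
  have h3 (l : List Symbol) : l.length * 8 + 1 ≤ size l := by
    induction l with
    | nil => simp
    | cons x l ih =>
      have := seven_le_size x
      simp; omega
  have h4 := h3 (w.takeWhile fun x => isDigit x)
  rw [List.length_map] at h1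
  have h5 := size_append (w.takeWhile fun x => isDigit x) (w.dropWhile fun x => isDigit x)
  rw [h2] at h5
  simp only
  rcases h6 : w.dropWhile fun x => isDigit x with _ | ⟨y, l⟩
  · rw [h6, List.append_nil] at h2
    rw [h6] at h5
    have : 0 < w.length := List.length_pos_iff.2 hw
    rw [h2] at h1 h4 h5 ⊢
    simp only [List.tail_nil, size_nil] at *
    omega
  · have := seven_le_size y
    rw [h6] at h5
    simp only [List.tail_cons, size_cons] at *
    omega

/-- Parse two values. -/
def parsePair (p : List Symbol → β × List Symbol) (q : List Symbol → γ × List Symbol)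
    (w : List Symbol) : (β × γ) × List Symbol :=
  (((p w).1, (q (p w).2).1), (q (p w).2).2)

theorem Poly.parsePair {p : List Symbol → β × List Symbol} {q : List Symbol → γ × List Symbol}
    (hp : Poly p) (hq : Poly q) : Poly (parsePair p q) := by
  unfold PolyTime.parsePair
  exact .pair (.pair (.fst' hp) (.fst' (hq.comp (.snd' hp)))) (.snd' (hq.comp (.snd' hp)))

/-- The three cells gained by `p` pay for the node of the pair and, if `p` has exhausted the word,
for the default output of `q` on the empty word. -/
theorem Shrinks.parsePair {p : List Symbol → β × List Symbol} {q : List Symbol → γ × List Symbol}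
    (hp : Shrinks 3 p) (hq : Shrinks 1 q) (hq0 : size (q []).1 + size (q []).2 ≤ 2) :
    Shrinks 1 (parsePair p q) := by
  intro w hw
  have h1 := hp w hw
  simp only [PolyTime.parsePair, size_pair]
  by_cases h : (p w).2 = []
  · rw [h] at h1 ⊢
    rw [size_nil] at h1
    omega
  · have := hq _ h
    omega

/-- One step in parsing a sequence: split off an entry unless the end is reached. -/
def seqStep (p : List Symbol → β × List Symbol) (x : List Symbol × List β) :
    List Symbol × List β :=
  -- The default `.ket` makes an exhausted word count as finished, so that `p` is never applied to
  -- the empty word.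
  if eqb (x.1.headD .ket) .ket then x else ((p x.1).2, (p x.1).1 :: x.2)

/-- Parse a sequence in brackets. -/
def parseSeq (p : List Symbol → β × List Symbol) (w : List Symbol) : List β × List Symbol :=
  ((w.foldl (fun x _ => seqStep p x) (w.tail, [])).2.reverse,
    (w.foldl (fun x _ => seqStep p x) (w.tail, [])).1.tail)

/-- Moving an entry from the word to the list of results never enlarges the state; therefore the
fold in `parseSeq` has growth bound zero. -/
theorem size_seqStep_le {p : List Symbol → β × List Symbol} (hp : Shrinks 1 p)
    (x : List Symbol × List β) : size (seqStep p x) ≤ size x := by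
  rw [seqStep]
  split_ifs with h
  · exact le_rfl
  · have := hp x.1 (by rintro h'; simp [h'] at h)
    rcases x with ⟨w, l⟩
    simp only [size_pair, size_cons] at *
    omega

theorem size_reverse (l : List β) : size l.reverse = size l := by
  induction l with
  | nil => rfl
  | cons b l ih =>
    have := size_append l.reverse [b]
    simp only [List.reverse_cons, size_cons, size_nil] at *
    omega

theorem Poly.parseSeq {p : List Symbol → β × List Symbol} (hp : Poly p) (hs : Shrinks 1 p) :
    Poly (parseSeq p) := by
  have h : Poly fun w : List Symbol => w.foldl (fun x _ => seqStep p x) (w.tail, []) := by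
    refine Poly.foldl (f := fun w => w) (g := fun w : List Symbol => (w.tail, ([] : List β)))
      (h := fun _ x _ => seqStep p x) .id (by fun_prop) ?_ (D := fun _ => 0) (.const _)
      fun a x b _ => size_seqStep_le hs x
    unfold seqStep
    fun_prop
  unfold PolyTime.parseSeq
  exact .pair (.reverse (.snd' h)) (.tail (.fst' h))

theorem shrinks_parseSeq {p : List Symbol → β × List Symbol} (hs : Shrinks 1 p) :
    Shrinks 3 (parseSeq p) := by
  intro w hw
  have key (k : List Symbol) (x : List Symbol × List β) :
      size (k.foldl (fun x _ => seqStep p x) x) ≤ size x := by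
    induction k generalizing x with
    | nil => exact le_rfl
    | cons y k ih => exact (ih _).trans (size_seqStep_le hs x)
  have h1 := key w (w.tail, [])
  rw [parseSeq]
  generalize w.foldl (fun x _ => seqStep p x) (w.tail, []) = x at *
  rcases x with ⟨y, l⟩
  have h2 := size_le_of_suffix (List.tail_suffix y)
  rcases w with _ | ⟨z, w⟩
  · exact absurd rfl hw
  · have := seven_le_size z
    simp only [size_reverse, size_pair, size_cons, List.tail_cons, size_nil] at *
    omega

-- The word itself serves as the clock. Each entry occupies at least one symbol, so there are enough
-- ticks; once the closing bracket is reached, further steps change nothing.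
omit [Enc β] in
theorem parseSeq_encode {p : List Symbol → β × List Symbol} {e : β → List Symbol}
    (hp : ∀ x r, p (e x ++ r) = (x, r)) (hk : ∀ x r t, e x ++ r ≠ Computability.Γ'.ket :: t)
    (l : List β) (r : List Symbol) : parseSeq p (encodeSeq e l ++ r) = (l, r) := by
  have hhead (x : β) (r : List Symbol) : eqb ((e x ++ r).headD .ket) .ket = false := by
    rcases h : e x ++ r with _ | ⟨y, t⟩
    · have := hk x [.ket] []
      simp_all
    · have : y ≠ .ket := by
        rintro rfl
        exact hk x r t h
      simpa [eqb] using this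
  have key (k : List Symbol) (l acc : List β) (hl : l.length ≤ k.length) :
      k.foldl (fun x _ => seqStep p x) (l.flatMap e ++ .ket :: r, acc) =
        (.ket :: r, l.reverse ++ acc) := by
    induction k generalizing l acc with
    | nil =>
      rw [List.length_nil, Nat.le_zero, List.length_eq_zero_iff] at hl
      simp [hl]
    | cons y k ih =>
      rw [List.foldl_cons]
      cases l with
      | nil =>
        have := ih [] acc (by simp)
        simpa [seqStep] using this
      | cons x l =>
        have h1 : seqStep p ((x :: l).flatMap e ++ .ket :: r, acc) =
            (l.flatMap e ++ .ket :: r, x :: acc) := by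
          rw [List.flatMap_cons, List.append_assoc, seqStep]
          simp only [hhead, hp, Bool.false_eq_true, if_false]
        rw [h1, ih l _ (by simpa using hl)]
        simp
  have hlen : l.length ≤ (encodeSeq e l ++ r).length := by
    have (l : List β) : l.length ≤ (l.flatMap e).length := by
      induction l with
      | nil => simp
      | cons x l ih =>
        have : 1 ≤ (e x).length := by
          rcases h : e x with _ | ⟨y, t⟩
          · have := hk x [.ket] []
            simp [h] at this
          · simp
        simp only [List.flatMap_cons, List.length_append, List.length_cons]
        omega
    have := this l
    simp only [encodeSeq, List.length_append, List.length_cons, List.cons_append]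
    omega
  have h := key _ l [] hlen
  rw [parseSeq]
  have ht : (encodeSeq e l ++ r).tail = l.flatMap e ++ .ket :: r := by simp [encodeSeq]
  rw [ht, h]
  simp

/-- Parse an instance of the manipulation problem, as a tuple. -/
def parseInstance : List Symbol → ((List ℕ × Profile) × List ℕ × ℕ) × List Symbol :=
  parsePair (parsePair (parseSeq parseNumber)
    (parseSeq (parsePair parseNumber (parseSeq (parseSeq parseNumber)))))
    (parsePair (parseSeq parseNumber) parseNumber)

theorem shrinks_parseVoter :
    Shrinks 1 (parsePair parseNumber (parseSeq (parseSeq parseNumber))) :=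
  shrinks_parseNumber.parsePair
    ((shrinks_parseSeq ((shrinks_parseSeq (shrinks_parseNumber.mono (by omega))).mono
      (by omega))).mono (by omega)) le_rfl

theorem poly_parseInstance : Poly parseInstance := by
  have h1 : Poly (parseSeq parseNumber) :=
    .parseSeq poly_parseNumber (shrinks_parseNumber.mono (by omega))
  have h2 : Poly (parseSeq (parseSeq parseNumber)) :=
    .parseSeq h1 ((shrinks_parseSeq (shrinks_parseNumber.mono (by omega))).mono (by omega))
  exact .parsePair (.parsePair h1 (.parseSeq (.parsePair poly_parseNumber h2) shrinks_parseVoter))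
    (.parsePair h1 poly_parseNumber)

/-- The instance with the given data. -/
def ofTuple (x : (List ℕ × Profile) × List ℕ × ℕ) : CWCMInstance :=
  ⟨x.1.1, x.1.2, x.2.1, x.2.2⟩

theorem parseInstance_encode (x : (List ℕ × Profile) × List ℕ × ℕ) :
    (parseInstance (ofTuple x).encode).1 = x := by
  rcases x with ⟨⟨C, V⟩, M, p⟩
  have h1 := parseSeq_encode parseNumber_encode encodeNumber_ne_ket
  have h2 := parseSeq_encode h1 (encodeSeq_ne_ket _)
  have h3 : ∀ x r, parsePair parseNumber (parseSeq (parseSeq parseNumber)) (encodeVoter x ++ r) =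
      (x, r) := by
    rintro ⟨w, v⟩ r
    simp only [parsePair, encodeVoter, List.append_assoc, parseNumber_encode]
    rw [show encodeVote v = encodeSeq (encodeSeq encodeNumber) v from rfl, h2]
  have h4 := parseSeq_encode h3 fun x r t => by
    simp only [encodeVoter, List.append_assoc]
    exact encodeNumber_ne_ket _ _ _
  simp only [parseInstance, parsePair, ofTuple, CWCMInstance.encode, h1, h4]
  have := parseNumber_encode p []
  rw [List.append_nil] at this
  rw [this]

/-! #### Encoding -/

@[fun_prop] theorem Poly.encodeNumber {f : α → ℕ} (hf : Poly f) :
    Poly fun a => encodeNumber (f a) := by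
  unfold TiedVoting.encodeNumber
  fun_prop

@[fun_prop] theorem Poly.encodeSeq {f : α → List β} {e : β → List Symbol} (hf : Poly f)
    (he : Poly e) : Poly fun a => encodeSeq e (f a) := by
  unfold TiedVoting.encodeSeq
  have : Poly fun a => (f a).flatMap fun b => e b := by fun_prop
  fun_prop

/-- Encoding again and comparing with the input rejects malformed words, so the parser need not
detect errors. -/
theorem poly_encode : Poly fun x => (ofTuple x).encode := by
  have h1 : Poly TiedVoting.encodeNumber := .encodeNumber .id
  have h2 : Poly (TiedVoting.encodeSeq TiedVoting.encodeNumber) := .encodeSeq .id h1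
  have h3 : Poly (TiedVoting.encodeSeq (TiedVoting.encodeSeq TiedVoting.encodeNumber)) :=
    .encodeSeq .id h2
  have h4 : Poly encodeVoter := by
    unfold encodeVoter encodeVote
    fun_prop
  unfold CWCMInstance.encode ofTuple
  fun_prop

end

end PolyTime

namespace PolyTime

open TiedVoting

/-! #### Tests on lists and votes -/

section

variable {α β γ : Type} [Enc α] [Enc β] [Enc γ]

/-- Membership as a truth value. -/
def memb [DecidableEq β] (b : β) (l : List β) : Bool := l.any fun c => eqb b c

omit [Enc β] in
@[simp] theorem memb_iff [DecidableEq β] (b : β) (l : List β) : memb b l = true ↔ b ∈ l := by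
  simp [memb]

@[fun_prop] theorem Poly.memb [DecidableEq β] [PolyEq β] {f : α → β} {g : α → List β}
    (hf : Poly f) (hg : Poly g) : Poly fun a => memb (f a) (g a) := by
  unfold PolyTime.memb
  fun_prop

@[fun_prop] theorem Poly.length {f : α → List β} (hf : Poly f) : Poly fun a => (f a).length := by
  have h : Poly fun a => ((f a).map fun _ => 1).sum := by fun_prop
  convert h using 2 with a
  simp

/-- Does the relation `R` hold for any two list entries in the order of the list? -/
def pairwiseb (R : ℕ → ℕ → Bool) (l : List ℕ) : Bool :=
  (splits l).all fun x => x.2.tail.all fun b => R (x.2.headD 0) b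

theorem pairwiseb_iff (R : ℕ → ℕ → Bool) (l : List ℕ) :
    pairwiseb R l = true ↔ l.Pairwise fun a b => R a b = true := by
  induction l with
  | nil => simp [pairwiseb, splits]
  | cons a l ih =>
    rw [List.pairwise_cons, ← ih]
    simp [pairwiseb, splits_cons]

@[fun_prop] theorem Poly.pairwiseb {f : α → List ℕ} {R : α → ℕ → ℕ → Bool} (hf : Poly f)
    (hR : Poly fun x : α × ℕ × ℕ => R x.1 x.2.1 x.2.2) :
    Poly fun a => pairwiseb (R a) (f a) := by
  unfold PolyTime.pairwiseb
  refine .all (h := fun a (x : List ℕ × List ℕ) => x.2.tail.all fun b => R a (x.2.headD 0) b)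
    (by fun_prop) (.all (by fun_prop) ?_)
  exact hR.comp (f := fun y : (α × List ℕ × List ℕ) × ℕ => (y.1.1, y.1.2.2.headD 0, y.2))
    (by fun_prop)

omit [Enc β] in
theorem findIdx_eq_length_takeWhile (p : β → Bool) (l : List β) :
    l.findIdx p = (l.takeWhile fun b => !p b).length := by
  induction l with
  | nil => rfl
  | cons b l ih =>
    rw [List.findIdx_cons, List.takeWhile_cons]
    cases p b <;> simp [ih]

@[fun_prop] theorem Poly.position {f : α → Vote} {g : α → ℕ} (hf : Poly f) (hg : Poly g) :
    Poly fun a => position (f a) (g a) := by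
  have h : Poly fun a => ((f a).takeWhile fun G => !PolyTime.memb (g a) G).length := by fun_prop
  convert h using 2 with a
  rw [TiedVoting.position, findIdx_eq_length_takeWhile]
  congr 2
  funext G
  rw [Bool.eq_iff_iff, Bool.not_eq_true', ← Bool.not_eq_true, Bool.not_eq_true',
    ← Bool.not_eq_true, memb_iff, decide_eq_true_iff]

/-- Strict preference as a truth value. -/
def prefersb (v : Vote) (a b : ℕ) : Bool := ltb (position v a) (position v b)

@[simp] theorem prefersb_iff (v : Vote) (a b : ℕ) : prefersb v a b = true ↔ Prefers v a b := by
  simp [prefersb, Prefers]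

@[fun_prop] theorem Poly.prefersb {f : α → Vote} {g h : α → ℕ} (hf : Poly f) (hg : Poly g)
    (hh : Poly h) : Poly fun a => prefersb (f a) (g a) (h a) := by
  unfold PolyTime.prefersb
  fun_prop

@[fun_prop] theorem Poly.support {f : α → Profile} {g h : α → ℕ} (hf : Poly f) (hg : Poly g)
    (hh : Poly h) : Poly fun a => support (f a) (g a) (h a) := by
  have h : Poly fun a => ((f a).map fun x =>
      if PolyTime.prefersb x.2 (g a) (h a) then x.1 else 0).sum := by fun_prop
  convert h using 2 with a
  simp [TiedVoting.support]

/-! #### Validity of instances -/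

/-- Is `v` a weak order on the candidates in `C`? -/
def weakOrderb (C : List ℕ) (v : Vote) : Bool :=
  (v.all fun G => !G.isEmpty) && pairwiseb (fun a b => !eqb a b) v.flatten &&
    (v.flatten.all fun a => memb a C) && C.all fun a => memb a v.flatten

/-- For lists without repetition, being a permutation means having the same members. -/
theorem weakOrderb_iff {C : List ℕ} (hC : C.Nodup) (v : Vote) :
    weakOrderb C v = true ↔ IsWeakOrder C v := by
  simp only [weakOrderb, Bool.and_eq_true, pairwiseb_iff, List.all_eq_true, memb_iff,
    Bool.not_eq_true', List.isEmpty_eq_false_iff, IsWeakOrder, and_assoc]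
  refine and_congr_right fun _ => ?_
  constructor
  · rintro ⟨h1, h2, h3⟩
    refine (List.perm_ext_iff_of_nodup (h1.imp fun h => ?_) hC).2 fun a => ⟨h2 a, h3 a⟩
    simpa [eqb] using h
  · intro h
    refine ⟨((h.nodup_iff).2 hC).imp fun h => ?_, fun a => h.mem_iff.1, fun a => h.mem_iff.2⟩
    simpa [eqb] using h

@[fun_prop] theorem Poly.weakOrderb {f : α → List ℕ} {g : α → Vote} (hf : Poly f) (hg : Poly g) :
    Poly fun a => weakOrderb (f a) (g a) := by
  unfold PolyTime.weakOrderb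
  fun_prop

/-- Is `v` of the given kind? -/
def kindb (k : OrderKind) (v : Vote) : Bool :=
  match k with
  | .top => v.dropLast.all fun G => eqb G.length 1
  | .bottom => v.tail.all fun G => eqb G.length 1
  | .weak => true

theorem kindb_iff (k : OrderKind) (v : Vote) : kindb k v = true ↔ k.Allows v := by
  cases k <;> simp [kindb, OrderKind.Allows]

@[fun_prop] theorem Poly.kindb (k : OrderKind) {f : α → Vote} (hf : Poly f) :
    Poly fun a => kindb k (f a) := by
  unfold PolyTime.kindb
  cases k <;> simp only <;> fun_prop

/-- Does `v` satisfy the given restriction for the axis `L`? -/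
def shapeb (s : Shape) (L : List ℕ) (v : Vote) : Bool :=
  (splits L).any fun x => (splits x.2).any fun y =>
    (L.all fun a => eqb (memb a y.1) (L.all fun b => !prefersb v b a)) &&
      pairwiseb (fun a b => prefersb v b a) x.1 && pairwiseb (fun a b => prefersb v a b) y.2 &&
      (match s with
        | .singlePeaked => eqb y.1.length 1
        | .singlePlateaued => true)

theorem shapeb_iff (s : Shape) (L : List ℕ) (v : Vote) :
    shapeb s L v = true ↔ s.Allows L v := by
  have h (X Y Z : List ℕ) : ((L.all fun a => eqb (memb a Y) (L.all fun b => !prefersb v b a)) &&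
      pairwiseb (fun a b => prefersb v b a) X && pairwiseb (fun a b => prefersb v a b) Z) = true ↔
      (∀ a ∈ L, a ∈ Y ↔ MostPreferred L v a) ∧ StrictlyIncreasing v X ∧
        StrictlyDecreasing v Z := by
    simp only [Bool.and_eq_true, pairwiseb_iff, List.all_eq_true, eqb_iff, prefersb_iff,
      StrictlyIncreasing, StrictlyDecreasing, and_assoc]
    refine and_congr_left fun _ => forall₂_congr fun a _ => ?_
    rw [Bool.eq_iff_iff, memb_iff]
    simp [MostPreferred, Prefers, prefersb, ltb]
  cases s
  · simp only [shapeb, List.any_eq_true, mem_splits, Bool.and_eq_true (_ && _ && _), h, eqb_iff,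
      Shape.Allows, SinglePeaked]
    constructor
    · rintro ⟨⟨X, W⟩, hL, ⟨Y, Z⟩, hW, hY, h1⟩
      obtain ⟨y, rfl⟩ := List.length_eq_one_iff.1 h1
      exact ⟨X, y, Z, by simp_all, by simpa using hY⟩
    · rintro ⟨X, y, Z, rfl, hy⟩
      exact ⟨⟨X, [y] ++ Z⟩, by simp, ⟨[y], Z⟩, rfl, by simpa using hy, rfl⟩
  · simp only [shapeb, List.any_eq_true, mem_splits, Bool.and_true, h, Shape.Allows,
      SinglePlateaued]
    constructor
    · rintro ⟨⟨X, W⟩, hL, ⟨Y, Z⟩, hW, hY⟩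
      exact ⟨X, Y, Z, by simp_all, hY⟩
    · rintro ⟨X, Y, Z, hL, hy⟩
      exact ⟨⟨X, Y ++ Z⟩, by simp [hL], ⟨Y, Z⟩, rfl, hy⟩

@[fun_prop] theorem Poly.shapeb (s : Shape) {f : α → List ℕ} {g : α → Vote} (hf : Poly f)
    (hg : Poly g) : Poly fun a => shapeb s (f a) (g a) := by
  unfold PolyTime.shapeb
  cases s <;> simp only <;> fun_prop

/-- Are the data a valid instance? -/
def validb (k : OrderKind) (s : Shape) (I : CWCMInstance) : Bool :=
  pairwiseb (fun a b => !eqb a b) I.axis && memb I.preferred I.axis &&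
    (I.nonmanipulators.all fun x => ltb 0 x.1 &&
      (weakOrderb I.axis x.2 && kindb k x.2 && shapeb s I.axis x.2)) &&
    I.manipulators.all fun w => ltb 0 w

theorem validb_iff (k : OrderKind) (s : Shape) (I : CWCMInstance) :
    validb k s I = true ↔ I.Valid k s := by
  simp only [validb, Bool.and_eq_true, pairwiseb_iff, memb_iff, List.all_eq_true, ltb_iff,
    kindb_iff, shapeb_iff, CWCMInstance.Valid, Admissible, and_assoc]
  have h0 : (I.axis.Pairwise fun a b => (!eqb a b) = true) ↔ I.axis.Nodup := by
    simp [List.Nodup, eqb]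
  rw [h0]
  refine and_congr_right fun hC => ?_
  simp only [weakOrderb_iff hC]

/-! #### Scores -/

/-- The Copeland score for `α = n / d`, multiplied by `d`. -/
def scaledScore (n d : ℕ) (C : List ℕ) (V : Profile) (a : ℕ) : ℕ :=
  (C.map fun b => if eqb b a then 0 else if ltb (support V b a) (support V a b) then d
    else if eqb (support V a b) (support V b a) then n else 0).sum

@[fun_prop] theorem Poly.scaledScore (n d : ℕ) {f : α → List ℕ} {g : α → Profile} {h : α → ℕ}
    (hf : Poly f) (hg : Poly g) (hh : Poly h) :
    Poly fun a => scaledScore n d (f a) (g a) (h a) := by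
  unfold PolyTime.scaledScore
  fun_prop

/-- Clearing the denominator of `α` keeps the computation within the natural numbers and does not
affect comparisons. -/
theorem scaledScore_eq {q : ℚ} {n d : ℕ} (hd : 0 < d) (hq : q = n / d) {C : List ℕ}
    (hC : C.Nodup) (V : Profile) (a : ℕ) :
    (scaledScore n d C V a : ℚ) = d * copelandScore q C.toFinset V a := by
  have hd' : (d : ℚ) ≠ 0 := by positivity
  have h1 : (scaledScore n d C V a : ℚ) = ∑ b ∈ C.toFinset, if b = a then 0 else
      if support V b a < support V a b then (d : ℚ)
      else if support V a b = support V b a then (n : ℚ) else 0 := by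
    rw [List.sum_toFinset _ hC, scaledScore, Nat.cast_list_sum, List.map_map]
    congr 1
    refine List.map_congr_left fun b _ => ?_
    simp only [Function.comp, eqb, ltb, decide_eq_true_eq]
    split_ifs <;> simp
  have h2 : (∑ b ∈ C.toFinset, if b = a then 0 else
      if support V b a < support V a b then (d : ℚ)
      else if support V a b = support V b a then (n : ℚ) else 0) =
      ∑ b ∈ C.toFinset.erase a, ((if support V b a < support V a b then (d : ℚ) else 0) +
        if support V a b = support V b a then (n : ℚ) else 0) := by
    have h3 : C.toFinset.erase a = C.toFinset.filter fun b => b ≠ a := by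
      ext b; simp [and_comm]
    rw [h3, Finset.sum_filter]
    refine Finset.sum_congr rfl fun b _ => ?_
    split_ifs <;> first | omega | simp_all
  rw [h1, h2, copelandScore, Finset.sum_add_distrib, ← Finset.sum_filter, ← Finset.sum_filter,
    Finset.sum_const, Finset.sum_const, hq, nsmul_eq_mul, nsmul_eq_mul]
  field_simp

/-- Is `p` a winner for `α = n / d`? -/
def winnerb (n d : ℕ) (C : List ℕ) (V : Profile) (p : ℕ) : Bool :=
  memb p C && C.all fun c => !ltb (scaledScore n d C V p) (scaledScore n d C V c)

theorem winnerb_iff {q : ℚ} {n d : ℕ} (hd : 0 < d) (hq : q = n / d) {C : List ℕ}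
    (hC : C.Nodup) (V : Profile) (p : ℕ) :
    winnerb n d C V p = true ↔ IsCopelandWinner q C.toFinset V p := by
  have hd' : (0 : ℚ) < d := by positivity
  simp only [winnerb, Bool.and_eq_true, memb_iff, List.all_eq_true, Bool.not_eq_true', ltb,
    decide_eq_false_iff_not, not_lt, IsCopelandWinner, List.mem_toFinset]
  refine and_congr_right fun _ => forall₂_congr fun c _ => ?_
  rw [← Nat.cast_le (α := ℚ), scaledScore_eq hd hq hC, scaledScore_eq hd hq hC,
    mul_le_mul_iff_right₀ hd']

@[fun_prop] theorem Poly.winnerb (n d : ℕ) {f : α → List ℕ} {g : α → Profile} {h : α → ℕ}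
    (hf : Poly f) (hg : Poly g) (hh : Poly h) :
    Poly fun a => winnerb n d (f a) (g a) (h a) := by
  unfold PolyTime.winnerb
  fun_prop

/-! #### The decision procedure -/

/-- The candidates to the left of `p`, from right to left. -/
def leftOf (L : List ℕ) (p : ℕ) : List ℕ := (L.takeWhile fun a => !eqb a p).reverse

/-- The candidates to the right of `p`, from left to right. -/
def rightOf (L : List ℕ) (p : ℕ) : List ℕ := (L.dropWhile fun a => !eqb a p).tail

/-- The vote that ranks `p` first, then the candidates on one side of `p`, then those on the other
side. -/
def ballot (L : List ℕ) (p : ℕ) (rightFirst : Bool) : Vote :=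
  [p] :: (if rightFirst then rightOf L p ++ leftOf L p else leftOf L p ++ rightOf L p).map
    fun a => [a]

@[fun_prop] theorem Poly.ballot (c : Bool) {f : α → List ℕ} {g : α → ℕ} (hf : Poly f)
    (hg : Poly g) : Poly fun a => ballot (f a) (g a) c := by
  unfold PolyTime.ballot leftOf rightOf
  cases c <;> simp only [if_true, Bool.false_eq_true, if_false] <;> fun_prop

/-- The profile in which all manipulators cast the same vote. -/
def unanimous (I : CWCMInstance) (v : Vote) : Profile :=
  I.nonmanipulators ++ I.manipulators.map fun w => (w, v)

/-- Is `I` valid, and does `p` win if all manipulators cast one of the two ballots? -/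
def solveb (n d : ℕ) (k : OrderKind) (s : Shape) (I : CWCMInstance) : Bool :=
  validb k s I &&
    (winnerb n d I.axis (unanimous I (ballot I.axis I.preferred true)) I.preferred ||
      winnerb n d I.axis (unanimous I (ballot I.axis I.preferred false)) I.preferred)

theorem poly_solveb (n d : ℕ) (k : OrderKind) (s : Shape) :
    Poly fun x => solveb n d k s (ofTuple x) := by
  unfold solveb validb unanimous ofTuple
  dsimp only
  fun_prop

/-- The decision procedure for `α = n / d`. -/
def decideCWCM (n d : ℕ) (k : OrderKind) (s : Shape) (w : List Symbol) : Bool :=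
  eqb (ofTuple (parseInstance w).1).encode w && solveb n d k s (ofTuple (parseInstance w).1)

theorem poly_decideCWCM (n d : ℕ) (k : OrderKind) (s : Shape) : Poly (decideCWCM n d k s) := by
  have h1 : Poly fun w => (parseInstance w).1 := poly_parseInstance.fst'
  unfold decideCWCM
  exact .and (.eqb (poly_encode.comp h1) .id) ((poly_solveb n d k s).comp h1)

theorem decideCWCM_iff (n d : ℕ) (k : OrderKind) (s : Shape) (w : List Symbol) :
    decideCWCM n d k s w = true ↔ ∃ I : CWCMInstance, I.encode = w ∧ solveb n d k s I = true := by
  rw [decideCWCM, Bool.and_eq_true, eqb_iff]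
  constructor
  · exact fun h => ⟨_, h⟩
  · rintro ⟨⟨C, V, M, p⟩, rfl, h⟩
    have h1 := parseInstance_encode ((C, V), M, p)
    have h2 : ofTuple ((C, V), M, p) = ⟨C, V, M, p⟩ := rfl
    rw [h2] at h1
    rw [h1]
    exact ⟨rfl, h⟩

end

end PolyTime

/-! ### Pairwise margins of single-plateaued profiles -/

namespace TiedVoting

/-- The sign of the preference of `v` between `a` and `b`. -/
def prefSign (v : Vote) (a b : ℕ) : ℤ :=
  if Prefers v a b then 1 else if Prefers v b a then -1 else 0

theorem prefSign_self (v : Vote) (a : ℕ) : prefSign v a a = 0 := by simp [prefSign, Prefers]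

theorem prefSign_le_one (v : Vote) (a b : ℕ) : prefSign v a b ≤ 1 := by
  unfold prefSign
  split_ifs <;> omega

theorem neg_one_le_prefSign (v : Vote) (a b : ℕ) : -1 ≤ prefSign v a b := by
  unfold prefSign
  split_ifs <;> omega

theorem prefSign_eq_one {v : Vote} {a b : ℕ} (h : Prefers v a b) : prefSign v a b = 1 := if_pos h

theorem prefSign_eq_neg_one {v : Vote} {a b : ℕ} : prefSign v a b = -1 ↔ Prefers v b a := by
  unfold prefSign Prefers
  split_ifs <;> omega

/-- The margin of the pairwise majority election between `a` and `b`. -/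
def margin (V : Profile) (a b : ℕ) : ℤ := (V.map fun x => (x.1 : ℤ) * prefSign x.2 a b).sum

theorem margin_eq_sub (V : Profile) (a b : ℕ) :
    margin V a b = (support V a b : ℤ) - support V b a := by
  induction V with
  | nil => simp [margin, support]
  | cons x V ih =>
    simp only [margin, support, List.map_cons, List.sum_cons] at *
    rw [ih]
    unfold prefSign
    split_ifs with h1 h2
    · unfold Prefers at *
      omega
    · push_cast
      ring
    · push_cast
      ring
    · push_cast
      ring

theorem margin_swap (V : Profile) (a b : ℕ) : margin V b a = -margin V a b := by
  rw [margin_eq_sub, margin_eq_sub]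
  ring

theorem margin_append (V W : Profile) (a b : ℕ) :
    margin (V ++ W) a b = margin V a b + margin W a b := by
  simp [margin]

theorem margin_le_margin {V : Profile} {a b c d : ℕ}
    (h : ∀ x ∈ V, prefSign x.2 a b ≤ prefSign x.2 c d) : margin V a b ≤ margin V c d :=
  List.sum_le_sum fun x hx => mul_le_mul_of_nonneg_left (h x hx) (Int.natCast_nonneg _)

/-- The points that a candidate receives for a pairwise election with margin `m`. -/
def points (α : ℚ) (m : ℤ) : ℚ := if 0 < m then 1 else if m = 0 then α else 0

theorem points_mono {α : ℚ} (h0 : 0 ≤ α) (h1 : α < 1) {m n : ℤ} (h : m ≤ n) :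
    points α m ≤ points α n := by
  unfold points
  split_ifs <;> first | omega | linarith

theorem points_le_one {α : ℚ} (h1 : α < 1) (m : ℤ) : points α m ≤ 1 := by
  unfold points
  split_ifs <;> linarith

theorem points_nonneg {α : ℚ} (h0 : 0 ≤ α) (m : ℤ) : 0 ≤ points α m := by
  unfold points
  split_ifs <;> linarith

theorem copelandScore_eq_sum (α : ℚ) (C : Finset ℕ) (V : Profile) (a : ℕ) :
    copelandScore α C V a = ∑ b ∈ C.erase a, points α (margin V a b) := by
  have h (b : ℕ) : points α (margin V a b) = (if support V b a < support V a b then 1 else 0) +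
      (if support V a b = support V b a then α else 0) := by
    rw [points, margin_eq_sub]
    split_ifs <;> first | omega | simp
  simp only [h, Finset.sum_add_distrib, ← Finset.sum_filter, Finset.sum_const, nsmul_eq_mul,
    copelandScore, mul_one]
  ring

theorem copelandScore_le_of_margin_le {α : ℚ} (h0 : 0 ≤ α) (h1 : α < 1) {C : Finset ℕ}
    {V W : Profile} {a : ℕ} (h : ∀ b ∈ C, margin V a b ≤ margin W a b) :
    copelandScore α C V a ≤ copelandScore α C W a := by
  rw [copelandScore_eq_sum, copelandScore_eq_sum]
  exact Finset.sum_le_sum fun b hb => points_mono h0 h1 (h b (Finset.mem_of_mem_erase hb))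

/-! #### Betweenness -/

/-- Along `x`, `y`, `z` the preferences of `v` do not decrease and then increase. -/
def Unimodal (v : Vote) (x y z : ℕ) : Prop :=
  (Prefers v x y → Prefers v y z) ∧ (Prefers v z y → Prefers v y x)

/-- If `z` is above `y`, then `y` is above `x`, so `z` is above `x` as well. If `y` and `z` are
tied, then `x` cannot be above `y`, as this would put `y` above `z`. -/
theorem Unimodal.prefSign_le {v : Vote} {x y z : ℕ} (h : Unimodal v x y z) :
    prefSign v x z ≤ prefSign v y z := by
  unfold Unimodal Prefers at h
  unfold prefSign Prefers
  split_ifs <;> omega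

/-- The votes are unimodal on the candidates in `C`, arranged according to `pos`. -/
def UnimodalOn (pos : ℕ → ℤ) (C : Finset ℕ) (V : Profile) : Prop :=
  ∀ x ∈ V, ∀ a ∈ C, ∀ b ∈ C, ∀ c ∈ C, pos a < pos b → pos b < pos c → Unimodal x.2 a b c

/-- Reflecting the axis; positions are integers so that one-sided arguments can be reused for the
other side. -/
theorem UnimodalOn.neg {pos : ℕ → ℤ} {C : Finset ℕ} {V : Profile} (h : UnimodalOn pos C V) :
    UnimodalOn (fun a => -pos a) C V := fun x hx a ha b hb c hc h1 h2 =>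
  And.symm (h x hx c hc b hb a ha (neg_lt_neg_iff.1 h2) (neg_lt_neg_iff.1 h1))

section

variable {α : ℚ} (h0 : 0 ≤ α) (h1 : α < 1) {C : Finset ℕ} {pos : ℕ → ℤ}
  (hpos : Set.InjOn pos C)
include h0 h1 hpos

/-- The scores are compared opponent by opponent. In the direct election `a` gets one point and `p`
none. Against any other `x`, the position of `x` relative to `p` and `a` shows that `a` does at
least as well. -/
theorem copelandScore_lt_of_pos_lt {V : Profile} (hV : UnimodalOn pos C V) {a p : ℕ} (ha : a ∈ C)
    (hp : p ∈ C) (hap : pos p < pos a) (h : 0 < margin V a p) :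
    copelandScore α C V p < copelandScore α C V a := by
  have hne : a ≠ p := by rintro rfl; exact lt_irrefl _ hap
  rw [copelandScore_eq_sum, copelandScore_eq_sum,
    ← Finset.add_sum_erase (C.erase p) _ (Finset.mem_erase.2 ⟨hne, ha⟩),
    ← Finset.add_sum_erase (C.erase a) _ (Finset.mem_erase.2 ⟨hne.symm, hp⟩),
    Finset.erase_right_comm]
  refine add_lt_add_of_lt_of_le ?_ (Finset.sum_le_sum fun x hx => ?_)
  · have h2 := margin_swap V a p
    have h3 : points α (margin V p a) = 0 := by
      unfold points
      rw [if_neg (by omega), if_neg (by omega)]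
    rw [h3, points, if_pos h]
    exact one_pos
  · simp only [Finset.mem_erase] at hx
    obtain ⟨hxp, hxa, hx⟩ := hx
    rcases lt_trichotomy (pos x) (pos p) with h2 | h2 | h2
    -- Here `p` lies between `x` and `a`: since `a` beats `p`, it also beats `x`.
    · have h3 : margin V x a ≤ margin V p a :=
        margin_le_margin fun y hy => (hV y hy x hx p hp a ha h2 hap).prefSign_le
      have h4 := margin_swap V a p
      have h5 := margin_swap V a x
      have h6 : points α (margin V a x) = 1 := if_pos (by omega)
      rw [h6]
      exact points_le_one h1 _
    · exact absurd (hpos hx hp h2) (by tauto)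
    · rcases lt_trichotomy (pos x) (pos a) with h3 | h3 | h3
      -- Here `x` lies between `p` and `a`, so `x` beats `p` as well.
      · have h4 : margin V a p ≤ margin V x p := margin_le_margin fun y hy =>
          Unimodal.prefSign_le (And.symm (hV y hy p hp x hx a ha h2 h3))
        have h5 := margin_swap V x p
        have h6 : points α (margin V p x) = 0 := by
          unfold points
          rw [if_neg (by omega), if_neg (by omega)]
        rw [h6]
        exact points_nonneg h0 _
      · exact absurd (hpos hx ha h3) (by tauto)
      · exact points_mono h0 h1
          (margin_le_margin fun y hy => (hV y hy p hp a ha x hx hap h3).prefSign_le)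

theorem margin_nonneg_of_isMax {V : Profile} (hV : UnimodalOn pos C V) {p : ℕ} (hp : p ∈ C)
    (h : ∀ c ∈ C, copelandScore α C V c ≤ copelandScore α C V p) {a : ℕ} (ha : a ∈ C) :
    0 ≤ margin V p a := by
  by_contra hlt
  have h2 := margin_swap V p a
  rcases lt_trichotomy (pos a) (pos p) with h3 | h3 | h3
  · have hneg : Set.InjOn (fun a => -pos a) C := fun x hx y hy h => hpos hx hy (neg_injective h)
    exact absurd (copelandScore_lt_of_pos_lt h0 h1 hneg hV.neg ha hp (neg_lt_neg h3) (by omega))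
      (not_lt.2 (h a ha))
  · rw [hpos ha hp h3] at hlt h2
    omega
  · exact absurd (copelandScore_lt_of_pos_lt h0 h1 hpos hV ha hp h3 (by omega))
      (not_lt.2 (h a ha))

/-- If all manipulators rank `p` first and the candidates below `p` on the axis last, then `p` still
wins, unless `p` is tied with a candidate above. -/
theorem isCopelandWinner_of_isCopelandWinner {N Z : Profile} {v : Vote} {p : ℕ}
    (hZ : ∀ x ∈ Z, 0 < x.1) (hU : UnimodalOn pos C (N ++ Z))
    (hU' : UnimodalOn pos C (N ++ Z.map fun x => (x.1, v)))
    (hfirst : ∀ x ∈ C, x ≠ p → Prefers v p x)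
    (hlast : ∀ c ∈ C, pos c < pos p → ∀ x ∈ C, pos c < pos x → Prefers v x c)
    (htie : ∀ d ∈ C, pos p < pos d → margin (N ++ Z.map fun x => (x.1, v)) d p ≠ 0)
    (h : IsCopelandWinner α C (N ++ Z) p) :
    IsCopelandWinner α C (N ++ Z.map fun x => (x.1, v)) p := by
  obtain ⟨hp, hmax⟩ := h
  refine ⟨hp, ?_⟩
  have hmap (a b : ℕ) : margin (Z.map fun x => (x.1, v)) a b =
      (Z.map fun x => (x.1 : ℤ) * prefSign v a b).sum := by
    rw [margin, List.map_map]
    rfl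
  have hle {a b : ℕ} (h : ∀ x ∈ Z, prefSign x.2 a b ≤ prefSign v a b) :
      margin (N ++ Z) a b ≤ margin (N ++ Z.map fun x => (x.1, v)) a b := by
    rw [margin_append, margin_append, hmap]
    exact (add_le_add_iff_left _).2 (List.sum_le_sum fun x hx =>
      mul_le_mul_of_nonneg_left (h x hx) (Int.natCast_nonneg _))
  have hge {a b : ℕ} (h : ∀ x ∈ Z, prefSign v a b ≤ prefSign x.2 a b) :
      margin (N ++ Z.map fun x => (x.1, v)) a b ≤ margin (N ++ Z) a b := by
    rw [margin_append, margin_append, hmap]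
    exact (add_le_add_iff_left _).2 (List.sum_le_sum fun x hx =>
      mul_le_mul_of_nonneg_left (h x hx) (Int.natCast_nonneg _))
  have hple (x : ℕ) (hx : x ∈ C) :
      margin (N ++ Z) p x ≤ margin (N ++ Z.map fun x => (x.1, v)) p x := by
    refine hle fun y _ => ?_
    by_cases hxp : x = p
    · rw [hxp, prefSign_self, prefSign_self]
    · rw [prefSign_eq_one (hfirst x hx hxp)]
      exact prefSign_le_one _ _ _
  -- It suffices to compare `p` with a new winner `c`, because a new winner is itself unbeaten.
  obtain ⟨c, hc, hcmax⟩ := C.exists_max_image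
    (copelandScore α C (N ++ Z.map fun x => (x.1, v))) ⟨p, hp⟩
  suffices hcp : copelandScore α C (N ++ Z.map fun x => (x.1, v)) c ≤
      copelandScore α C (N ++ Z.map fun x => (x.1, v)) p from
    fun a ha => (hcmax a ha).trans hcp
  by_cases hne : c = p
  · rw [hne]
  have hp0 := margin_nonneg_of_isMax h0 h1 hpos hU hp hmax hc
  have hc0 := margin_nonneg_of_isMax h0 h1 hpos hU' hc hcmax hp
  have hswap := margin_swap (N ++ Z) p c
  have hswap' := margin_swap (N ++ Z.map fun x => (x.1, v)) p c
  have htied : margin (N ++ Z.map fun x => (x.1, v)) c p = 0 := by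
    have := hple c hc
    omega
  have hcp : pos c < pos p := by
    rcases lt_trichotomy (pos c) (pos p) with h2 | h2 | h2
    · exact h2
    · exact absurd (hpos hc hp h2) hne
    · exact absurd htied (htie c hc h2)
  have hv : prefSign v c p = -1 := prefSign_eq_neg_one.2 (hfirst c hc hne)
  -- A manipulator not preferring `p` to `c` would have given `c` a larger margin over `p` before
  -- than the present zero, so `p` would have been beaten.
  have hall : ∀ x ∈ Z, Prefers x.2 p c := by
    by_contra! hex
    obtain ⟨x, hx, hxp⟩ := hex
    have hlt : (Z.map fun x => (x.1 : ℤ) * prefSign v c p).sum <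
        (Z.map fun x => (x.1 : ℤ) * prefSign x.2 c p).sum := by
      refine List.sum_lt_sum _ _ (fun y _ => ?_) ⟨x, hx, ?_⟩
      · rw [hv]
        exact mul_le_mul_of_nonneg_left (neg_one_le_prefSign _ _ _) (Int.natCast_nonneg _)
      · have h2 := neg_one_le_prefSign x.2 c p
        have h3 : prefSign x.2 c p ≠ -1 := fun h => hxp (prefSign_eq_neg_one.1 h)
        have h4 : (0 : ℤ) < x.1 := by exact_mod_cast hZ x hx
        exact mul_lt_mul_of_pos_left (by omega) h4
    rw [margin_append, hmap] at htied
    rw [margin_append N Z c p, show margin Z c p =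
      (Z.map fun x => (x.1 : ℤ) * prefSign x.2 c p).sum from rfl] at hswap
    omega
  -- Beyond `c`, the old votes already favoured `c` by unimodality; on the side of `p`, the new
  -- ballot gives `c` no support.
  have hcle (x : ℕ) (hx : x ∈ C) :
      margin (N ++ Z.map fun x => (x.1, v)) c x ≤ margin (N ++ Z) c x := by
    refine hge fun y hy => ?_
    rcases lt_trichotomy (pos x) (pos c) with h2 | h2 | h2
    · have h3 := (hU y (List.mem_append_right _ hy) x hx c hc p hp h2 hcp).2 (hall y hy)
      rw [prefSign_eq_one h3]
      exact prefSign_le_one _ _ _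
    · rw [hpos hx hc h2, prefSign_self, prefSign_self]
    · rw [prefSign_eq_neg_one.2 (hlast c hc hcp x hx h2)]
      exact neg_one_le_prefSign _ _ _
  calc copelandScore α C (N ++ Z.map fun x => (x.1, v)) c
      ≤ copelandScore α C (N ++ Z) c := copelandScore_le_of_margin_le h0 h1 hcle
    _ ≤ copelandScore α C (N ++ Z) p := hmax c hc
    _ ≤ copelandScore α C (N ++ Z.map fun x => (x.1, v)) p := copelandScore_le_of_margin_le h0 h1 hple

end

end TiedVoting

/-! ### The two ballots -/

namespace TiedVoting

/-! ### From positions on the axis to unimodality. -/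

theorem sublist_of_idxOf_lt {L : List ℕ} {x y : ℕ} (hy : y ∈ L) (h : L.idxOf x < L.idxOf y) :
    [x, y].Sublist L := by
  induction L with
  | nil => simp at hy
  | cons a L ih =>
    by_cases hya : y = a
    · simp [hya] at h
    have hy' : y ∈ L := (List.mem_cons.1 hy).resolve_left hya
    by_cases hxa : x = a
    · rw [hxa]
      exact .cons_cons a (List.singleton_sublist.2 hy')
    · rw [List.idxOf_cons_ne _ (Ne.symm hxa), List.idxOf_cons_ne _ (Ne.symm hya)] at h
      exact .cons a (ih hy' (by omega))

theorem sublist_of_idxOf_lt_of_idxOf_lt {L : List ℕ} {x y z : ℕ} (hz : z ∈ L)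
    (h : L.idxOf x < L.idxOf y) (h' : L.idxOf y < L.idxOf z) : [x, y, z].Sublist L := by
  induction L with
  | nil => simp at hz
  | cons a L ih =>
    have hya : y ≠ a := by
      rintro rfl
      simp at h
    have hza : z ≠ a := by
      rintro rfl
      simp at h'
    have hz' : z ∈ L := (List.mem_cons.1 hz).resolve_left hza
    rw [List.idxOf_cons_ne _ hya.symm, List.idxOf_cons_ne _ hza.symm] at h'
    by_cases hxa : x = a
    · rw [hxa]
      exact .cons_cons a (sublist_of_idxOf_lt hz' (by omega))
    · rw [List.idxOf_cons_ne _ (Ne.symm hxa), List.idxOf_cons_ne _ hya.symm] at h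
      exact .cons a (ih hz' (by omega) (by omega))

theorem rel_of_idxOf_lt {L : List ℕ} {R : ℕ → ℕ → Prop} (hL : L.Pairwise R) {x y : ℕ}
    (hy : y ∈ L) (h : L.idxOf x < L.idxOf y) : R x y :=
  List.pairwise_pair.1 (hL.sublist (sublist_of_idxOf_lt hy h))

theorem injOn_idxOf (L : List ℕ) : Set.InjOn (fun a => (L.idxOf a : ℤ)) L.toFinset :=
  fun _ hx _ _ h => (List.idxOf_inj (List.mem_toFinset.1 hx)).1 (Int.ofNat_inj.1 h)

/-- Only the segment of the middle candidate matters: in `X` it is above `x`, in `Z` it is above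
`z`, and in `Y` nothing is above it. Each of these suffices. -/
theorem SinglePlateaued.unimodal {L : List ℕ} {v : Vote} (h : SinglePlateaued L v) {x y z : ℕ}
    (hs : [x, y, z].Sublist L) : Unimodal v x y z := by
  obtain ⟨X, Y, Z, hL, hY, hX, hZ⟩ := h
  have hyz : Prefers v y z → Unimodal v x y z := fun h =>
    ⟨fun _ => h, fun h' => absurd h (lt_asymm h')⟩
  have hyx : Prefers v y x → Unimodal v x y z := fun h =>
    ⟨fun h' => absurd h (lt_asymm h'), fun _ => h⟩
  have hy : y ∈ Y → Unimodal v x y z := fun h => by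
    have hm := (hY y (hs.subset (by simp))).1 h
    exact ⟨fun h' => absurd h' (hm x (hs.subset (by simp))),
      fun h' => absurd h' (hm z (hs.subset (by simp)))⟩
  rw [hL] at hs
  -- The part `l` of `[x, y, z]` within `X ++ Y` has length at most one exactly when `y` falls into
  -- `Z`.
  obtain ⟨l, m, hlm, hl, hm⟩ := List.sublist_append_iff.1 hs
  match l, hlm with
  | [], hlm =>
    obtain rfl : [x, y, z] = m := hlm
    exact hyz (List.pairwise_pair.1 (hZ.sublist ((List.sublist_cons_self _ _).trans hm)))
  | [_], hlm =>
    obtain ⟨rfl, rfl⟩ := List.cons.inj hlm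
    exact hyz (List.pairwise_pair.1 (hZ.sublist hm))
  | a :: b :: l, hlm =>
    simp only [List.cons_append, List.cons.injEq] at hlm
    obtain ⟨rfl, rfl, -⟩ := hlm
    have hxy : [x, y].Sublist (X ++ Y) := .trans (by simp) hl
    obtain ⟨l', m', hlm', hl', hm'⟩ := List.sublist_append_iff.1 hxy
    match l', hlm' with
    | [], hlm' =>
      obtain rfl : [x, y] = m' := hlm'
      exact hy (hm'.subset (by simp))
    | [_], hlm' =>
      obtain ⟨-, rfl⟩ := List.cons.inj hlm'
      exact hy (hm'.subset (by simp))
    | c :: d :: l', hlm' =>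
      simp only [List.cons_append, List.cons.injEq] at hlm'
      obtain ⟨rfl, rfl, -⟩ := hlm'
      have hxy' : [x, y].Sublist X := .trans (by simp) hl'
      have hpref := List.pairwise_pair.1 (List.Pairwise.sublist hxy' hX)
      exact hyx hpref

theorem Admissible.singlePlateaued {k : OrderKind} {s : Shape} {L : List ℕ} {v : Vote}
    (h : Admissible k s L v) : SinglePlateaued L v := by
  cases s with
  | singlePeaked =>
    obtain ⟨X, y, Z, h1, h2, h3⟩ := h.2.2
    exact ⟨X, [y], Z, h1, by simpa using h2, h3⟩
  | singlePlateaued => exact h.2.2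

theorem unimodalOn_of_admissible {k : OrderKind} {s : Shape} {L : List ℕ} {V : Profile}
    (h : ∀ x ∈ V, Admissible k s L x.2) :
    UnimodalOn (fun a => (L.idxOf a : ℤ)) L.toFinset V := fun x hx _ _ _ _ _ hc h1 h2 =>
  (h x hx).singlePlateaued.unimodal (sublist_of_idxOf_lt_of_idxOf_lt (List.mem_toFinset.1 hc)
    (Int.ofNat_lt.1 h1) (Int.ofNat_lt.1 h2))

/-! #### Votes without ties -/

/-- The vote that ranks the candidates in the order of the list. -/
def linearVote (O : List ℕ) : Vote := O.map fun a => [a]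

theorem position_linearVote (O : List ℕ) (a : ℕ) : position (linearVote O) a = O.idxOf a := by
  rw [position, linearVote, List.findIdx_map, List.idxOf]
  congr 1
  funext b
  rw [Bool.eq_iff_iff, Function.comp, decide_eq_true_iff, List.mem_singleton, beq_iff_eq, eq_comm]

theorem pairwise_prefers_linearVote {O : List ℕ} (h : O.Nodup) :
    O.Pairwise (Prefers (linearVote O)) := by
  rw [List.pairwise_iff_getElem]
  intro i j hi hj hij
  rw [Prefers, position_linearVote, position_linearVote, h.idxOf_getElem, h.idxOf_getElem]
  exact hij

theorem linearVote_cons_prefers {p x : ℕ} (O : List ℕ) (h : x ≠ p) :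
    Prefers (linearVote (p :: O)) p x := by
  rw [Prefers, position_linearVote, position_linearVote, List.idxOf_cons_self,
    List.idxOf_cons_ne _ h.symm]
  exact Nat.succ_pos _

/-- Any interleaving `O` of the two sides, each read outwards from `p`, gives a single-peaked vote
with peak `p`. Since it has no ties, all kinds allow it. -/
theorem admissible_linearVote (k : OrderKind) (s : Shape) {A R O : List ℕ} {p : ℕ}
    (hL : (A ++ p :: R).Nodup) (hO : (p :: O).Perm (A ++ p :: R)) (hA : A.reverse.Sublist O)
    (hR : R.Sublist O) : Admissible k s (A ++ p :: R) (linearVote (p :: O)) := by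
  have hpw := pairwise_prefers_linearVote (hO.nodup_iff.2 hL)
  have h1 : ∀ G ∈ linearVote (p :: O), G.length = 1 := by simp [linearVote]
  have hpeak : SinglePeaked (A ++ p :: R) (linearVote (p :: O)) := by
    refine ⟨A, p, R, by simp, fun a ha => ?_, List.pairwise_reverse.1 (hpw.sublist (hA.cons _)),
      hpw.sublist (hR.cons _)⟩
    constructor
    · rintro rfl b _ h
      rw [Prefers, position_linearVote, position_linearVote, List.idxOf_cons_self] at h
      exact Nat.not_lt_zero _ h
    · intro h
      by_contra hne
      exact h p (by simp) (linearVote_cons_prefers O hne)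
  have hweak : IsWeakOrder (A ++ p :: R) (linearVote (p :: O)) := by
    refine ⟨fun G hG h => by simpa [h] using h1 G hG, ?_⟩
    rwa [linearVote, ← List.flatMap_def, List.flatMap_singleton']
  refine ⟨hweak, ?_, ?_⟩
  · cases k with
    | top => exact fun G hG => h1 G (List.mem_of_mem_dropLast hG)
    | bottom => exact fun G hG => h1 G (List.mem_of_mem_tail hG)
    | weak => trivial
  · cases s with
    | singlePeaked => exact hpeak
    | singlePlateaued =>
      exact Admissible.singlePlateaued (k := .weak) (s := .singlePeaked) ⟨hweak, trivial, hpeak⟩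

theorem right_first_perm (A R : List ℕ) (p : ℕ) :
    (p :: (R ++ A.reverse)).Perm (A ++ p :: R) :=
  (List.perm_append_comm (l₁ := p :: R)).trans ((A.reverse_perm).append_right _)

theorem left_first_perm (A R : List ℕ) (p : ℕ) :
    (p :: (A.reverse ++ R)).Perm (A ++ p :: R) :=
  (((A.reverse_perm).append_right R).cons p).trans List.perm_middle.symm

/-! ### Candidates on the side that a ballot ranks last. -/

section

variable {A R : List ℕ} {p : ℕ} (hL : (A ++ p :: R).Nodup)
include hL

theorem mem_left_of_idxOf_lt {c : ℕ} (h : (A ++ p :: R).idxOf c < (A ++ p :: R).idxOf p) :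
    c ∈ A := by
  -- The claim is phrased as a relation between earlier and later entries, so that it can be checked
  -- segment by segment.
  refine rel_of_idxOf_lt (R := fun a b => b = p → a ∈ A) ?_ (by simp) h rfl
  simp only [List.nodup_append, List.nodup_cons] at hL
  refine List.pairwise_append.2 ⟨List.Pairwise.imp_of_mem (fun ha _ _ _ => ha) hL.1,
    List.pairwise_cons.2 ⟨fun b hb h => absurd (h ▸ hb) hL.2.1.1,
      List.Pairwise.imp_of_mem (fun _ hb _ h => absurd (h ▸ hb) hL.2.1.1) hL.2.1.2⟩,
    fun a ha _ _ _ => ha⟩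

theorem mem_right_of_idxOf_lt {c : ℕ} (hc : c ∈ A ++ p :: R)
    (h : (A ++ p :: R).idxOf p < (A ++ p :: R).idxOf c) : c ∈ R := by
  rcases List.mem_append.1 hc with h1 | h1
  · rw [List.idxOf_append_of_mem h1, List.idxOf_append_of_notMem
      (fun h => (List.nodup_append.1 hL).2.2 p h p (by simp) rfl)] at h
    have := List.idxOf_lt_length_of_mem h1
    omega
  · rcases List.mem_cons.1 h1 with rfl | h1
    · exact absurd h (lt_irrefl _)
    · exact h1

theorem right_first_last {c x : ℕ} (hx : x ∈ A ++ p :: R)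
    (hc : (A ++ p :: R).idxOf c < (A ++ p :: R).idxOf p)
    (h : (A ++ p :: R).idxOf c < (A ++ p :: R).idxOf x) :
    Prefers (linearVote (p :: (R ++ A.reverse))) x c := by
  have hpw := pairwise_prefers_linearVote ((right_first_perm A R p).nodup_iff.2 hL)
  have hpw' := List.pairwise_append.1 (show List.Pairwise _ ((p :: R) ++ A.reverse) from hpw)
  refine rel_of_idxOf_lt (R := fun a b => a ∈ A →
    Prefers (linearVote (p :: (R ++ A.reverse))) b a) ?_ hx h (mem_left_of_idxOf_lt hL hc)
  have hd := (List.nodup_append.1 hL).2.2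
  exact List.pairwise_append.2 ⟨(List.pairwise_reverse.1 hpw'.2.1).imp fun {a b} h (_ : a ∈ A) => h,
    List.Pairwise.imp_of_mem (fun ha _ _ h => absurd rfl (hd _ h _ ha)) hpw'.1,
    fun a ha b hb _ => hpw'.2.2 b hb a (List.mem_reverse.2 ha)⟩

theorem left_first_last {c x : ℕ} (hc' : c ∈ A ++ p :: R)
    (hc : (A ++ p :: R).idxOf p < (A ++ p :: R).idxOf c)
    (h : (A ++ p :: R).idxOf x < (A ++ p :: R).idxOf c) :
    Prefers (linearVote (p :: (A.reverse ++ R))) x c := by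
  have hpw := pairwise_prefers_linearVote ((left_first_perm A R p).nodup_iff.2 hL)
  have hpw' := List.pairwise_append.1 (show List.Pairwise _ ((p :: A.reverse) ++ R) from hpw)
  refine rel_of_idxOf_lt (R := fun a b => b ∈ R →
    Prefers (linearVote (p :: (A.reverse ++ R))) a b) ?_ hc' h (mem_right_of_idxOf_lt hL hc' hc)
  have hd := (List.nodup_append.1 hL).2.2
  exact List.pairwise_append.2 ⟨List.Pairwise.imp_of_mem
      (fun _ hb _ h => absurd rfl (hd _ hb _ (List.mem_cons_of_mem _ h))) (List.nodup_append.1 hL).1,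
    List.pairwise_cons.2 ⟨fun b hb _ => hpw'.2.2 p (by simp) b hb, hpw'.2.1.imp fun {a b} h (_ : b ∈ R) => h⟩,
    fun a ha b _ h => hpw'.2.2 a (by simp [ha]) b h⟩

end

end TiedVoting

/-! ### The manipulation problem -/

namespace TiedVoting

open PolyTime

/-- A vote that ranks one neighbour above the middle candidate ranks the other one below it. In
total, a majority for both neighbours is therefore impossible. -/
theorem Unimodal.prefSign_add_le {v : Vote} {x y z : ℕ} (h : Unimodal v x y z) :
    prefSign v x y + prefSign v z y ≤ 0 := by
  unfold Unimodal Prefers at h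
  unfold prefSign Prefers
  split_ifs <;> omega

theorem margin_add_le {V : Profile} {x y z : ℕ} (h : ∀ u ∈ V, Unimodal u.2 x y z) :
    margin V x y + margin V z y ≤ 0 := by
  induction V with
  | nil => simp [margin]
  | cons u V ih =>
    have h1 := ih fun u hu => h u (List.mem_cons_of_mem _ hu)
    have h2 := mul_nonpos_of_nonneg_of_nonpos (Int.natCast_nonneg u.1)
      (h u List.mem_cons_self).prefSign_add_le
    simp only [margin, List.map_cons, List.sum_cons] at *
    linarith

theorem margin_map_eq {M : List ℕ} {v : Vote} {a b : ℕ} :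
    margin (M.map fun w => (w, v)) a b = M.sum * prefSign v a b := by
  induction M with
  | nil => simp [margin]
  | cons w M ih =>
    simp only [margin, List.map_cons, List.sum_cons] at *
    rw [ih]
    push_cast
    ring

/-- Since `p` is first on both ballots, the margins between `p` and the others do not depend on
which ballot is cast. So the ties of `p` can be inspected in one profile, and they determine which
side is to be ranked last. -/
theorem manipulable_iff {α : ℚ} (h0 : 0 ≤ α) (h1 : α < 1) {k : OrderKind} {s : Shape}
    {I : CWCMInstance} (hI : I.Valid k s) :
    I.Manipulable α k s ↔
      IsCopelandWinner α I.axis.toFinset (unanimous I (ballot I.axis I.preferred true))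
          I.preferred ∨
        IsCopelandWinner α I.axis.toFinset (unanimous I (ballot I.axis I.preferred false))
          I.preferred := by
  obtain ⟨L, N, M, p⟩ := I
  obtain ⟨hL, hp, hN, hM⟩ := hI
  dsimp only at hL hp hN hM
  obtain ⟨A, R, rfl⟩ := List.append_of_mem hp
  have hpA : p ∉ A := fun h => (List.nodup_append.1 hL).2.2 p h p (by simp) rfl
  have hA : ∀ a ∈ A, (!eqb a p) = true := by
    intro a ha
    have : a ≠ p := by
      rintro rfl
      exact hpA ha
    simp [eqb, this]
  have hleft : leftOf (A ++ p :: R) p = A.reverse := by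
    rw [leftOf, List.takeWhile_append_of_pos hA, List.takeWhile_cons_of_neg (by simp [eqb]),
      List.append_nil]
  have hright : rightOf (A ++ p :: R) p = R := by
    rw [rightOf, List.dropWhile_append_of_pos hA, List.dropWhile_cons_of_neg (by simp [eqb]),
      List.tail_cons]
  have hbr : ballot (A ++ p :: R) p true = linearVote (p :: (R ++ A.reverse)) := by
    rw [ballot, hleft, hright, if_pos rfl]
    rfl
  have hbl : ballot (A ++ p :: R) p false = linearVote (p :: (A.reverse ++ R)) := by
    rw [ballot, hleft, hright, if_neg Bool.false_ne_true]
    rfl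
  have hadr := admissible_linearVote k s hL (right_first_perm A R p)
    (List.sublist_append_right R A.reverse) (List.sublist_append_left R A.reverse)
  have hadl := admissible_linearVote k s hL (left_first_perm A R p)
    (List.sublist_append_left A.reverse R) (List.sublist_append_right A.reverse R)
  simp only [unanimous, hbr, hbl, CWCMInstance.Manipulable]
  set L := A ++ p :: R with hLdef
  set vr := linearVote (p :: (R ++ A.reverse)) with hvr
  set vl := linearVote (p :: (A.reverse ++ R)) with hvl
  have hUN (Z : Profile) (hZ : ∀ x ∈ Z, Admissible k s L x.2) :
      UnimodalOn (fun a => (L.idxOf a : ℤ)) L.toFinset (N ++ Z) :=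
    unimodalOn_of_admissible fun x hx => (List.mem_append.1 hx).elim (fun h => (hN x h).2) (hZ x)
  have hUv (v : Vote) (hv : Admissible k s L v) :
      UnimodalOn (fun a => (L.idxOf a : ℤ)) L.toFinset (N ++ M.map fun w => (w, v)) :=
    hUN _ fun x hx => by
      obtain ⟨w, -, rfl⟩ := List.mem_map.1 hx
      exact hv
  constructor
  · rintro ⟨votes, hlen, hadm, hwin⟩
    have hmap (v : Vote) : ((M.zip votes).map fun x => (x.1, v)) = M.map fun w => (w, v) := by
      rw [show (fun x : ℕ × Vote => (x.1, v)) = (fun w => (w, v)) ∘ Prod.fst from rfl,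
        ← List.map_map, List.map_fst_zip hlen.ge]
    have hZ : ∀ x ∈ M.zip votes, 0 < x.1 := fun x hx => hM _ (List.of_mem_zip hx).1
    have hU := hUN (M.zip votes) fun x hx => hadm _ (List.of_mem_zip hx).2
    have hUr := hUv vr hadr
    have hUl := hUv vl hadl
    have hinj := injOn_idxOf L
    by_cases hM0 : M = []
    · subst hM0
      exact Or.inl (by simpa using hwin)
    have hsum : (0 : ℤ) < M.sum := by
      exact_mod_cast List.sum_pos M hM hM0
    -- A tie on the left calls for the right-first ballot; if there is none, the left-first ballot
    -- works.
    by_cases hex : ∃ c ∈ L, L.idxOf c < L.idxOf p ∧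
        margin (N ++ M.map fun w => (w, vr)) c p = 0
    · obtain ⟨c, hc, hcp, hc0⟩ := hex
      left
      rw [← hmap] at hUr ⊢
      refine isCopelandWinner_of_isCopelandWinner h0 h1 hinj hZ hU hUr
        (fun x _ hne => linearVote_cons_prefers _ hne)
        (fun c _ hcp x hx hcx => right_first_last hL (List.mem_toFinset.1 hx)
          (Int.ofNat_lt.1 hcp) (Int.ofNat_lt.1 hcx)) (fun d hd hpd htie => ?_) hwin
      rw [hmap, margin_append, margin_map_eq, prefSign_eq_neg_one.2] at htie
      · rw [margin_append, margin_map_eq, prefSign_eq_neg_one.2] at hc0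
        -- Ties with `c` and `d` would mean that both beat `p` among the nonmanipulators by the
        -- positive weight `M.sum`, although these two margins have a sum of at most zero.
        · have := margin_add_le (V := N) (x := c) (y := p) (z := d) fun u hu =>
            hU u (List.mem_append_left _ hu) c (List.mem_toFinset.2 hc) p
              (List.mem_toFinset.2 hp) d hd (Int.ofNat_lt.2 hcp) hpd
          omega
        · refine linearVote_cons_prefers _ ?_
          rintro rfl
          exact lt_irrefl _ hcp
      · refine linearVote_cons_prefers _ ?_
        rintro rfl
        exact lt_irrefl _ hpd
    · right
      rw [← hmap] at hUl ⊢
      have hneg : Set.InjOn (fun a => -(L.idxOf a : ℤ)) L.toFinset :=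
        fun x hx y hy h => hinj hx hy (neg_injective h)
      -- The same lemma on the reflected axis.
      refine isCopelandWinner_of_isCopelandWinner h0 h1 hneg hZ hU.neg hUl.neg
        (fun x _ hne => linearVote_cons_prefers _ hne)
        (fun c hc hcp x _ hcx => left_first_last hL (List.mem_toFinset.1 hc)
          (Int.ofNat_lt.1 (neg_lt_neg_iff.1 hcp)) (Int.ofNat_lt.1 (neg_lt_neg_iff.1 hcx)))
        (fun d hd hpd htie => hex ⟨d, List.mem_toFinset.1 hd,
          Int.ofNat_lt.1 (neg_lt_neg_iff.1 hpd), ?_⟩) hwin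
      have hdp : d ≠ p := by
        rintro rfl
        exact lt_irrefl _ hpd
      rw [hmap, margin_append, margin_map_eq,
        prefSign_eq_neg_one.2 (linearVote_cons_prefers _ hdp)] at htie
      rw [margin_append, margin_map_eq, prefSign_eq_neg_one.2 (linearVote_cons_prefers _ hdp)]
      exact htie
  · have hback (v : Vote) (hv : Admissible k s L v)
        (h : IsCopelandWinner α L.toFinset (N ++ M.map fun w => (w, v)) p) :
        ∃ votes : List Vote, votes.length = M.length ∧ (∀ v ∈ votes, Admissible k s L v) ∧
          IsCopelandWinner α L.toFinset (N ++ M.zip votes) p := by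
      refine ⟨M.map fun _ => v, by simp, fun u hu => ?_, ?_⟩
      · obtain ⟨_, -, rfl⟩ := List.mem_map.1 hu
        exact hv
      · have hzip : (M.zip (M.map fun _ => v)) = M.map fun w => (w, v) := by
          rw [List.zip, List.zipWith_map_right, List.zipWith_self]
        rwa [hzip]
    rintro (h | h)
    · exact hback vr hadr h
    · exact hback vl hadl h

end TiedVoting

theorem mainTheorem3 (α : ℚ) (hα₀ : 0 ≤ α) (hα₁ : α < 1)
    (k : TiedVoting.OrderKind) (s : TiedVoting.Shape) :
    TiedVoting.InP (TiedVoting.copelandCWCM α k s) := by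
  -- Since `α` is nonnegative, its numerator can be taken as a natural number for the scaled scores.
  have hα : α = (α.num.toNat : ℚ) / α.den := by
    have h : ((α.num.toNat : ℤ) : ℚ) = α.num := by
      rw [Int.toNat_of_nonneg (Rat.num_nonneg.2 hα₀)]
    rw [← Int.cast_natCast (R := ℚ), h, Rat.num_div_den]
  refine PolyTime.Poly.inP (PolyTime.poly_decideCWCM α.num.toNat α.den k s) fun w => ?_
  rw [PolyTime.decideCWCM_iff]
  refine exists_congr fun I => and_congr_right fun _ => ?_
  rw [PolyTime.solveb, Bool.and_eq_true, PolyTime.validb_iff, Bool.or_eq_true]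
  refine and_congr_right fun hI => ?_
  rw [PolyTime.winnerb_iff α.den_pos hα hI.1, PolyTime.winnerb_iff α.den_pos hα hI.1,
    TiedVoting.manipulable_iff hα₀ hα₁ hI]
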